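/- Let $r\in\mathbb{N}$ and $d_i,a_i,b_i>0$ $(i=1,2)$. The self-excited threshold Poisson autoregression (SETPAR) model consists of counts $Y_t$ and intensities $\lambda_t\ge 0$, $t\ge 0$, such that, conditionally on the past (which determines $\lambda_0,\dots,\lambda_t$ and $Y_0,\dots,Y_{t-1}$), $Y_t$ has the Poisson distribution with mean $\lambda_t$, and $$\lambda_{t+1}=\begin{cases} d_1+a_1\lambda_t+b_1Y_t, & Y_t\le r,\\ d_2+a_2\lambda_t+b_2Y_t, & Y_t>r.\end{cases}$$ The process $\{\lambda_t\}$ is a Markov chain on $[0,\infty)$ whose transition probability $\mathbf{P}(x,\cdot)$ is the law of $d_1+a_1x+b_1N$ if $N\le r$ and $d_2+a_2x+b_2N$ if $N>r$, where $N$ is Poisson with mean $x$. Assume $a_1<1$ and $a_2+b_2<1$. Then: 1. The Markov chain $\{\lambda_t\}$ possesses a unique invariant probability measure $\mu$, and it is stable with stationary distribution $\mu$: for every initial distribution, almost surely the empirical distributions $\frac1{n+1}\sum_{t=0}^n\delta_{\lambda_t}$ converge weakly to $\mu$. Moreover $\mu$ has moments of all orders: $\int\lambda^s\,\mu(d\lambda)<\infty$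 for every real $s\ge 0$. 2. For every function $\phi:[0,\infty)\to\mathbb{R}$ that is continuous at $\mu$-almost every point and satisfies $|\phi(\lambda)|\le c(1+\lambda^k)$ for all $\lambda\ge0$, for some constants $c$ and $k\ge 0$, $\phi$ is $\mu$-integrable and, for any (possibly random) initial value $\lambda_0$, $$\frac1n\left[\phi(\lambda_1)+\cdots+\phi(\lambda_n)\right]\to\int\phi\,d\mu\quad\text{almost surely.}$$ -/

import Mathlib

open MeasureTheory ProbabilityTheory Filter Topology
open scoped NNReal ENNReal

noncomputable section

/-- Parameters of the two-regime self-excited threshold Poisson autoregression: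
strictly positive intercepts and coefficients, and an integer threshold `r`. -/
structure SETPARParams where
  d₁ : ℝ≥0
  a₁ : ℝ≥0
  b₁ : ℝ≥0
  d₂ : ℝ≥0
  a₂ : ℝ≥0
  b₂ : ℝ≥0
  r : ℕ
  d₁_pos : 0 < d₁
  a₁_pos : 0 < a₁
  b₁_pos : 0 < b₁
  d₂_pos : 0 < d₂
  a₂_pos : 0 < a₂
  b₂_pos : 0 < b₂

namespace SETPARParams

/-- The intensity recursion: the next intensity as a function of the current intensity `x` and
the current count `y`. -/
def step (θ : SETPARParams) (x : ℝ≥0) (y : ℕ) : ℝ≥0 :=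
  if y ≤ θ.r then θ.d₁ + θ.a₁ * x + θ.b₁ * (y : ℝ≥0) else θ.d₂ + θ.a₂ * x + θ.b₂ * (y : ℝ≥0)

theorem continuous_step (θ : SETPARParams) (y : ℕ) : Continuous fun x => θ.step x y := by
  unfold step
  split_ifs <;> fun_prop

/-- The transition kernel of the intensity chain: from `x`, draw `y` from the Poisson law with
mean `x` and move to `θ.step x y`. -/
def kernel (θ : SETPARParams) : Kernel ℝ≥0 ℝ≥0 where
  toFun x := (poissonMeasure x).map (θ.step x)
  measurable' := by
    refine Measure.measurable_of_measurable_coe _ fun s hs => ?_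
    have h : ∀ x : ℝ≥0, (poissonMeasure x).map (θ.step x) s =
        ∑' n : ℕ, ENNReal.ofReal (Real.exp (-(x : ℝ)) * (x : ℝ) ^ n / (n.factorial : ℝ)) *
          s.indicator 1 (θ.step x n) := by
      intro x
      rw [Measure.map_apply (Measurable.of_discrete) hs, poissonMeasure,
        Measure.sum_apply _ (MeasurableSet.of_discrete)]
      refine tsum_congr fun n => ?_
      simp [Set.indicator, Set.mem_preimage]
      rfl
    simp_rw [h]
    refine Measurable.tsum fun n => Measurable.mul (by fun_prop) ?_
    exact (measurable_one.indicator hs).comp (θ.continuous_step n).measurable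

instance (θ : SETPARParams) : IsMarkovKernel θ.kernel :=
  ⟨fun _ => Measure.isProbabilityMeasure_map Measurable.of_discrete.aemeasurable⟩

end SETPARParams

/-- The (one-sided in time) SETPAR model. Here `𝓕 t` is the information available just before the
count `Y t` is observed: it contains `lam 0, …, lam t` and `Y 0, …, Y (t - 1)`, and conditionally
on `𝓕 t` the count `Y t` is Poisson with mean `lam t`. -/
structure IsSETPAR (θ : SETPARParams) {Ω : Type*} {mΩ : MeasurableSpace Ω} (P : Measure Ω)
    (𝓕 : Filtration ℕ mΩ) (lam : ℕ → Ω → ℝ≥0) (Y : ℕ → Ω → ℕ) : Prop where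
  measurable_lam : ∀ t, Measurable[𝓕 t] (lam t)
  measurable_count : ∀ t, Measurable[𝓕 (t + 1)] (Y t)
  condLaw : ∀ t k : ℕ, P[(Y t ⁻¹' {k}).indicator (fun _ => (1 : ℝ)) | 𝓕 t] =ᵐ[P]
    fun ω => (poissonMeasure (lam t ω)).real {k}
  recursion : ∀ t, ∀ᵐ ω ∂P, lam (t + 1) ω = θ.step (lam t ω) (Y t ω)

/-- The law, on the space of trajectories, of the time-homogeneous Markov chain with transition
kernel `κ` and initial distribution `ν`. -/
def markovChainLaw {E : Type*} [MeasurableSpace E] (κ : Kernel E E) [IsMarkovKernel κ]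
    (ν : Measure E) : Measure (ℕ → E) :=
  Kernel.trajMeasure (X := fun _ => E) ν fun n =>
    κ.comap (fun h : (Finset.Iic n → E) => h ⟨n, Finset.mem_Iic.2 le_rfl⟩)
      (measurable_pi_apply _)

/-- The empirical distribution of the first `n + 1` terms `x 0, …, x n` of a sequence. -/
def empiricalDistribution {E : Type*} [MeasurableSpace E] (x : ℕ → E) (n : ℕ) :
    ProbabilityMeasure E :=
  ⟨((n : ℝ≥0∞) + 1)⁻¹ • ∑ t ∈ Finset.range (n + 1), Measure.dirac (x t), ⟨by
    have h0 : (n : ℝ≥0∞) + 1 ≠ 0 := by simp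
    have h1 : (n : ℝ≥0∞) + 1 ≠ ⊤ := by simp
    simp [Measure.finsetSum_apply, ENNReal.inv_mul_cancel h0 h1]⟩⟩

/-- A random sequence `X` is a stable model with stationary distribution `μ`: almost surely, its
empirical distributions converge weakly to `μ`. -/
def IsStableModel {E Ω : Type*} [TopologicalSpace E] [MeasurableSpace E] [OpensMeasurableSpace E]
    [MeasurableSpace Ω] (P : Measure Ω) (X : ℕ → Ω → E) (μ : ProbabilityMeasure E) : Prop :=
  ∀ᵐ ω ∂P, Tendsto (fun n => empiricalDistribution (fun t => X t ω) n) atTop (𝓝 μ)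

/-- The Markov chain with transition kernel `κ` is stable with stationary distribution `μ`: for
every initial distribution the chain is a stable model with stationary distribution `μ`. -/
def IsStableChain {E : Type*} [MetricSpace E] [MeasurableSpace E] [BorelSpace E]
    (κ : Kernel E E) [IsMarkovKernel κ] (μ : ProbabilityMeasure E) : Prop :=
  ∀ (ν : Measure E) [IsProbabilityMeasure ν],
    IsStableModel (markovChainLaw κ ν) (fun t x => x t) μ

end

/-! The proof rests on a drift condition and a coupling. For the drift, take `V x = exp (s x)` with
`s` small. In the lower regime the count is at most `r`, so that branch contributes at most a
constant times `exp (s a₁ x)`. In the upper regime the Poisson moment generating function gives the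
exponent `x (s a₂ + exp (s b₂) - 1)`, which is `s x (a₂ + b₂)` to first order in `s`. Since `a₁ < 1`
and `a₂ + b₂ < 1`, both are negligible against `exp (s x)`, so `κ V ≤ V / 2 + K`
(`exists_isLyapunov_exp`). No condition on `b₁` is needed.

The transition laws are discrete and typically mutually singular for different starting points, so
contraction is sought in a distance rather than in total variation. For `x ≤ y`, write the count
from `y` as the count from `x` plus an independent Poisson excess of mean `y - x`. With probability
`exp (-(y - x))` the counts agree; both chains then use the same affine branch and their distance
shrinks by `ρ = max a₁ a₂ < 1`. Otherwise the bounded distance `1 - exp (-c |x - y|)` is estimated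
by 1. For `c = 2 / (1 - ρ)` this distance is never expanded on average, and is contracted at a rate
uniform on each sublevel set of `V x + V y` (`isWeakContraction_expDist`).

The weak Harris argument combines the two: in the distance `√(d (1 + β V + β V))` the kernel is a
strict contraction on observables, by Cauchy–Schwarz (`exists_contraction_weightedDist`). This
yields a unique invariant `μ` that integrates `V`, hence has all moments, and geometric convergence
`κ^j f → ∫ f dμ` weighted by `V` for bounded Lipschitz `f` (`exists_invariant`).

For the strong law, the differences `f(x_{t+1}) - κf(x_t)` are orthogonal, so their averages vanish
almost surely and `f` may be replaced by `κ^j f` in time averages. The remaining error is a small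
multiple of the average of `V`, bounded by the drift and the same martingale estimate
(`ae_tendsto_average`). A countable determining class upgrades this to weak convergence of empirical
laws; Lipschitz minorants and truncation, with `φ² ≤ A V`, reach the unbounded almost everywhere
continuous `φ`. -/

section MarkovChainLaw

/-! ### Trajectory laws of Markov chains and their characterisation. -/

variable {E : Type*} [MeasurableSpace E] {κ : Kernel E E} [IsMarkovKernel κ]

instance (ν : Measure E) [IsProbabilityMeasure ν] : IsProbabilityMeasure (markovChainLaw κ ν) := by
  unfold markovChainLaw; infer_instance

/-- The transition kernel from the history up to time `a` to the state at time `a + 1`. -/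
noncomputable def historyKernel (κ : Kernel E E) (a : ℕ) : Kernel (Finset.Iic a → E) E :=
  κ.comap (fun h : (Finset.Iic a → E) => h ⟨a, Finset.mem_Iic.2 le_rfl⟩) (measurable_pi_apply _)

instance (a : ℕ) : IsMarkovKernel (historyKernel κ a) := by
  unfold historyKernel; infer_instance

theorem markovChainLaw_compProd (ν : Measure E) [IsProbabilityMeasure ν] (a : ℕ) :
    (markovChainLaw κ ν).map (Preorder.frestrictLe (π := fun _ : ℕ => E) a) ⊗ₘ historyKernel κ a =
      (markovChainLaw κ ν).map
        (fun x => (Preorder.frestrictLe (π := fun _ : ℕ => E) a x, x (a + 1))) :=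
  Kernel.map_frestrictLe_trajMeasure_compProd_eq_map_trajMeasure (X := fun _ => E)

theorem markovChainLaw_map_frestrictLe_zero (ν : Measure E) [IsProbabilityMeasure ν] :
    (markovChainLaw κ ν).map (Preorder.frestrictLe (π := fun _ : ℕ => E) 0) =
      ν.map (MeasurableEquiv.piUnique (fun _ : Finset.Iic 0 => E)).symm := by
  unfold markovChainLaw Kernel.trajMeasure
  rw [Measure.map_comp _ _ (by fun_prop), Kernel.traj_map_frestrictLe, Kernel.partialTraj_self,
    Measure.id_comp]

theorem markovChainLaw_map_zero (ν : Measure E) [IsProbabilityMeasure ν] :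
    (markovChainLaw κ ν).map (fun x => x 0) = ν := by
  have h : (fun x : ℕ → E => x 0) =
      (MeasurableEquiv.piUnique (fun _ : Finset.Iic 0 => E)) ∘
        Preorder.frestrictLe (π := fun _ : ℕ => E) 0 := by
    ext x; simp; rfl
  rw [h, ← Measure.map_map (by fun_prop) (by fun_prop), markovChainLaw_map_frestrictLe_zero]
  exact MeasurableEquiv.map_map_symm _

/-- The law of a Markov chain is characterised by its initial distribution and its transitions. -/
theorem eq_markovChainLaw {η : Measure (ℕ → E)} [IsProbabilityMeasure η] {ν : Measure E}
    [IsProbabilityMeasure ν] (h0 : η.map (fun x => x 0) = ν)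
    (hs : ∀ a, η.map (Preorder.frestrictLe (π := fun _ : ℕ => E) a) ⊗ₘ historyKernel κ a =
      η.map (fun x => (Preorder.frestrictLe (π := fun _ : ℕ => E) a x, x (a + 1)))) :
    η = markovChainLaw κ ν := by
  have hfr : ∀ n, η.map (Preorder.frestrictLe (π := fun _ : ℕ => E) n) =
      (markovChainLaw κ ν).map (Preorder.frestrictLe (π := fun _ : ℕ => E) n) := by
    intro n
    induction n with
    | zero =>
      have h : (Preorder.frestrictLe (π := fun _ : ℕ => E) 0) =
          (fun y (_ : Finset.Iic 0) => y) ∘ fun x : ℕ → E => x 0 := by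
        ext x i
        have : (i : ℕ) = 0 := Nat.le_zero.1 (Finset.mem_Iic.1 i.2)
        simp [this]
      have hm : Measurable (fun (y : E) (_ : Finset.Iic 0) => y) := by fun_prop
      rw [h, ← Measure.map_map hm (by fun_prop), ← Measure.map_map hm (by fun_prop), h0,
        markovChainLaw_map_zero]
    | succ n ih =>
      -- `g` glues a history up to time `n` and the next state into a history up to time `n + 1`;
      -- the joint law of this pair is fixed by the induction hypothesis and the transition.
      let g : (Finset.Iic n → E) × E → (Finset.Iic (n + 1) → E) := fun p i =>
        if h : (i : ℕ) ≤ n then p.1 ⟨i, Finset.mem_Iic.2 h⟩ else p.2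
      have hg : Measurable g := by
        refine measurable_pi_lambda _ fun i => ?_
        by_cases h : (i : ℕ) ≤ n
        · simp only [g, h, dite_true]; fun_prop
        · simp only [g, h, dite_false]; fun_prop
      have h : (Preorder.frestrictLe (π := fun _ : ℕ => E) (n + 1)) =
          g ∘ fun x => (Preorder.frestrictLe (π := fun _ : ℕ => E) n x, x (n + 1)) := by
        ext x i
        by_cases h : (i : ℕ) ≤ n
        · simp [g, h]
        · have hi : (i : ℕ) = n + 1 := by
            have := Finset.mem_Iic.1 i.2
            omega
          simp [g, hi]
      rw [h, ← Measure.map_map hg (by fun_prop), ← Measure.map_map hg (by fun_prop), ← hs, ih,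
        markovChainLaw_compProd]
  have hp : IsProjectiveMeasureFamily (α := fun _ : ℕ => E)
      (fun I : Finset ℕ => (markovChainLaw κ ν).map (I.restrict (π := fun _ : ℕ => E))) := by
    intro I J hJI
    simp only
    rw [Measure.map_map (Finset.measurable_restrict₂ (X := fun _ => E) hJI) (by fun_prop)]
    rfl
  have h1 : IsProjectiveLimit η
      (fun I : Finset ℕ => (markovChainLaw κ ν).map (I.restrict (π := fun _ : ℕ => E))) := by
    rw [isProjectiveLimit_nat_iff hp]
    exact hfr
  exact h1.unique fun I => rfl

/-- Allows almost sure statements to be proved from a more integrable initial law and then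
transferred. -/
theorem markovChainLaw_absolutelyContinuous {ν ν' : Measure E} (h : ν ≪ ν') :
    markovChainLaw κ ν ≪ markovChainLaw κ ν' := by
  unfold markovChainLaw Kernel.trajMeasure
  exact Measure.AbsolutelyContinuous.comp_right (h.map (by fun_prop)) _

end MarkovChainLaw

/-! ### The Markov property of the intensity process. -/

theorem IsSETPAR.map_eq_markovChainLaw {θ : SETPARParams} {Ω : Type*} {mΩ : MeasurableSpace Ω}
    {P : Measure Ω} [IsProbabilityMeasure P] {𝓕 : Filtration ℕ mΩ} {lam : ℕ → Ω → ℝ≥0}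
    {Y : ℕ → Ω → ℕ} (h : IsSETPAR θ P 𝓕 lam Y) :
    P.map (fun ω t => lam t ω) = markovChainLaw θ.kernel (P.map (lam 0)) := by
  have hlam : ∀ t, Measurable (lam t) := fun t => (h.measurable_lam t).mono (𝓕.le t) le_rfl
  have hY : ∀ t, Measurable (Y t) := fun t => (h.measurable_count t).mono (𝓕.le _) le_rfl
  have hm : Measurable (fun ω t => lam t ω) := measurable_pi_lambda _ hlam
  have : IsProbabilityMeasure (P.map (fun ω t => lam t ω)) :=
    Measure.isProbabilityMeasure_map hm.aemeasurable
  have : IsProbabilityMeasure (P.map (lam 0)) :=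
    Measure.isProbabilityMeasure_map (hlam 0).aemeasurable
  refine eq_markovChainLaw ?_ fun a => ?_
  · rw [Measure.map_map (by fun_prop) hm]; rfl
  rw [Measure.map_map (by fun_prop) hm, Measure.map_map (by fun_prop) hm]
  set H : Ω → (Finset.Iic a → ℝ≥0) := Preorder.frestrictLe (π := fun _ : ℕ => ℝ≥0) a ∘
    fun ω t => lam t ω with hH
  have hHa : Measurable[𝓕 a] H := by
    refine @measurable_pi_lambda _ _ _ (𝓕 a) _ _ fun i => ?_
    exact (h.measurable_lam i).mono (𝓕.mono (Finset.mem_Iic.1 i.2)) le_rfl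
  have hHm : Measurable H := hHa.mono (𝓕.le a) le_rfl
  have : IsProbabilityMeasure (P.map H) := Measure.isProbabilityMeasure_map hHm.aemeasurable
  refine Measure.ext_prod fun {A B} hA hB => ?_
  -- Once the count is frozen at `k`, the event that the next intensity lies in `B` is known at time
  -- `a`, so the conditional law of the count can be integrated over it. Summing over `k` then
  -- recovers the transition kernel.
  have hcount : ∀ k : ℕ, P ((H ⁻¹' A ∩ {ω | θ.step (lam a ω) k ∈ B}) ∩ Y a ⁻¹' {k}) =
      ∫⁻ ω in H ⁻¹' A ∩ {ω | θ.step (lam a ω) k ∈ B}, poissonMeasure (lam a ω) {k} ∂P := by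
    intro k
    set G := H ⁻¹' A ∩ {ω | θ.step (lam a ω) k ∈ B}
    have hG : MeasurableSet[𝓕 a] G := by
      refine MeasurableSet.inter (hHa hA) ?_
      exact ((θ.continuous_step k).measurable.comp (h.measurable_lam a)) hB
    have hint : Integrable ((Y a ⁻¹' {k}).indicator (fun _ => (1 : ℝ))) P :=
      (integrable_const _).indicator (hY a (measurableSet_singleton k))
    have h1 := setIntegral_condExp (𝓕.le a) hint hG
    rw [setIntegral_congr_ae (g := fun ω => (poissonMeasure (lam a ω)).real {k}) (𝓕.le a _ hG)
      ((h.condLaw a k).mono fun ω hω _ => hω),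
      setIntegral_indicator (hY a (measurableSet_singleton k))] at h1
    simp only [integral_const, MeasurableSet.univ, measureReal_restrict_apply, Set.univ_inter,
      smul_eq_mul, mul_one] at h1
    have hmeas : Measurable fun ω => (poissonMeasure (lam a ω)).real {k} := by
      simp only [poissonMeasure_real_singleton]
      have := hlam a
      fun_prop
    rw [integral_eq_lintegral_of_nonneg_ae (ae_of_all _ fun _ => measureReal_nonneg)
      hmeas.aestronglyMeasurable] at h1
    simp only [ofReal_measureReal, measure_ne_top, ne_eq, not_false_eq_true] at h1
    rw [measureReal_def, ENNReal.toReal_eq_toReal_iff' ?_ (by finiteness)] at h1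
    · exact h1.symm
    · refine ne_of_lt (lt_of_le_of_lt (lintegral_mono fun _ => prob_le_one) ?_)
      simp
  have hsplit : P ((fun ω => (H ω, lam (a + 1) ω)) ⁻¹' A ×ˢ B) =
      ∑' k : ℕ, P ((H ⁻¹' A ∩ {ω | θ.step (lam a ω) k ∈ B}) ∩ Y a ⁻¹' {k}) := by
    rw [← measure_iUnion]
    · refine measure_congr ?_
      filter_upwards [h.recursion a] with ω hω
      apply propext
      change (H ω ∈ A ∧ lam (a + 1) ω ∈ B) ↔ ω ∈ ⋃ k, _
      simp [hω]
    · intro i j hij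
      refine Disjoint.mono Set.inter_subset_right Set.inter_subset_right ?_
      exact Disjoint.preimage _ (by simpa using hij)
    · intro k
      exact ((hHm hA).inter (((θ.continuous_step k).measurable.comp (hlam a)) hB)).inter
        (hY a (measurableSet_singleton k))
  rw [Measure.compProd_apply_prod hA hB, setLIntegral_map hA
    (Kernel.measurable_coe _ hB) hHm, Measure.map_apply (by fun_prop) (hA.prod hB)]
  refine Eq.trans ?_ hsplit.symm
  simp_rw [hcount]
  have hS : ∀ k, MeasurableSet {ω | θ.step (lam a ω) k ∈ B} := fun k =>
    ((θ.continuous_step k).measurable.comp (hlam a)) hB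
  have hk : ∀ ω, historyKernel θ.kernel a (H ω) B =
      ∑' k : ℕ, {ω | θ.step (lam a ω) k ∈ B}.indicator
        (fun ω => poissonMeasure (lam a ω) {k}) ω := by
    intro ω
    change (poissonMeasure (lam a ω)).map (θ.step (lam a ω)) B = _
    rw [Measure.map_apply Measurable.of_discrete hB,
      ← Measure.tsum_indicator_apply_singleton _ _ MeasurableSet.of_discrete]
    rfl
  simp_rw [hk]
  have hpm : ∀ k, Measurable fun ω => poissonMeasure (lam a ω) {k} := by
    intro k
    simp only [poissonMeasure_singleton]
    have := hlam a
    fun_prop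
  rw [lintegral_tsum fun k => ((hpm k).indicator (hS k)).aemeasurable]
  refine tsum_congr fun k => ?_
  rw [lintegral_indicator (hS k), Measure.restrict_restrict (hS k), Set.inter_comm]

/-! ### Lyapunov functions and martingale differences. -/

section Martingale

variable {E : Type*} [MeasurableSpace E] {κ : Kernel E E}

/-- The transition operator `f ↦ ∫ f(y) κ(·, dy)` of a kernel, acting on real functions. -/
noncomputable def transOp (κ : Kernel E E) (f : E → ℝ) (x : E) : ℝ := ∫ y, f y ∂κ x

/-- `V ≥ 1` is a Lyapunov function of the kernel `κ`, with geometric drift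
`κ V ≤ γ V + K`, `γ < 1`. -/
structure IsLyapunov (κ : Kernel E E) (V : E → ℝ) (γ K : ℝ) : Prop where
  measurable : Measurable V
  one_le : ∀ x, 1 ≤ V x
  rate_nonneg : 0 ≤ γ
  rate_lt_one : γ < 1
  const_nonneg : 0 ≤ K
  integrable : ∀ x, Integrable V (κ x)
  drift : ∀ x, transOp κ V x ≤ γ * V x + K

theorem measurable_transOp {f : E → ℝ} (hf : Measurable f) : Measurable (transOp κ f) :=
  (hf.stronglyMeasurable.integral_kernel (κ := κ)).measurable

theorem abs_transOp_le [IsMarkovKernel κ] {f : E → ℝ} {b : ℝ} (hb : ∀ x, |f x| ≤ b) (x : E) :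
    |transOp κ f x| ≤ b := by
  simpa [transOp] using norm_integral_le_of_norm_le_const (μ := κ x) (f := f) (ae_of_all _ hb)

theorem measurable_iterate_transOp {f : E → ℝ} (hf : Measurable f) (j : ℕ) :
    Measurable ((transOp κ)^[j] f) := by
  induction j with
  | zero => exact hf
  | succ j ih => rw [Function.iterate_succ_apply']; exact measurable_transOp ih

theorem abs_iterate_transOp_le [IsMarkovKernel κ] {f : E → ℝ} {b : ℝ} (hb : ∀ x, |f x| ≤ b)
    (j : ℕ) (x : E) : |(transOp κ)^[j] f x| ≤ b := by
  induction j generalizing x with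
  | zero => exact hb x
  | succ j ih => rw [Function.iterate_succ_apply']; exact abs_transOp_le ih x

theorem integrable_of_abs_le {ρ : Measure E} [IsFiniteMeasure ρ] {f : E → ℝ} (hf : Measurable f)
    {b : ℝ} (hb : ∀ x, |f x| ≤ b) : Integrable f ρ :=
  Integrable.of_bound hf.aestronglyMeasurable b (ae_of_all _ hb)

namespace IsLyapunov

variable {V : E → ℝ} {γ K : ℝ} (hV : IsLyapunov κ V γ K)
include hV

theorem integrable_of_abs_le_mul {f : E → ℝ} (hf : Measurable f) {A : ℝ}
    (hA : ∀ x, |f x| ≤ A * V x) (x : E) : Integrable f (κ x) :=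
  ((hV.integrable x).const_mul A).mono' hf.aestronglyMeasurable (ae_of_all _ hA)

theorem abs_transOp_le_mul {f : E → ℝ} {A : ℝ} (hA0 : 0 ≤ A)
    (hA : ∀ x, |f x| ≤ A * V x) (x : E) : |transOp κ f x| ≤ A * (γ + K) * V x := by
  have h1 : |transOp κ f x| ≤ ∫ y, A * V y ∂κ x :=
    norm_integral_le_of_norm_le (f := f) ((hV.integrable x).const_mul A) (ae_of_all _ hA)
  rw [integral_const_mul] at h1
  have h2 : A * ∫ y, V y ∂κ x ≤ A * (γ * V x + K) :=
    mul_le_mul_of_nonneg_left (hV.drift x) hA0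
  have h3 : A * K * 1 ≤ A * K * V x :=
    mul_le_mul_of_nonneg_left (hV.one_le x) (mul_nonneg hA0 hV.const_nonneg)
  linarith

end IsLyapunov

/-- The martingale difference `f(x_{t+1}) - (κ f)(x_t)` along a trajectory. -/
noncomputable def mdiff (κ : Kernel E E) (f : E → ℝ) (t : ℕ) (x : ℕ → E) : ℝ :=
  f (x (t + 1)) - transOp κ f (x t)

theorem measurable_mdiff {f : E → ℝ} (hf : Measurable f) (t : ℕ) : Measurable (mdiff κ f t) :=
  (hf.comp (measurable_pi_apply _)).sub ((measurable_transOp hf).comp (measurable_pi_apply _))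

variable [IsMarkovKernel κ] {ν : Measure E} [IsProbabilityMeasure ν]

theorem integrable_markovChainLaw_succ_iff (a : ℕ) {F : (Finset.Iic a → E) × E → ℝ}
    (hF : Measurable F) :
    Integrable (fun x => F (Preorder.frestrictLe (π := fun _ : ℕ => E) a x, x (a + 1)))
      (markovChainLaw κ ν) ↔
    Integrable F ((markovChainLaw κ ν).map (Preorder.frestrictLe (π := fun _ : ℕ => E) a) ⊗ₘ
      historyKernel κ a) := by
  rw [markovChainLaw_compProd, integrable_map_measure hF.aestronglyMeasurable (by fun_prop)]
  rfl

theorem integral_markovChainLaw_succ (a : ℕ) {F : (Finset.Iic a → E) × E → ℝ} (hF : Measurable F)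
    (hi : Integrable (fun x => F (Preorder.frestrictLe (π := fun _ : ℕ => E) a x, x (a + 1)))
      (markovChainLaw κ ν)) :
    ∫ x, F (Preorder.frestrictLe (π := fun _ : ℕ => E) a x, x (a + 1)) ∂markovChainLaw κ ν =
      ∫ x, ∫ y, F (Preorder.frestrictLe (π := fun _ : ℕ => E) a x, y) ∂κ (x a)
        ∂markovChainLaw κ ν := by
  have h1 := (integrable_markovChainLaw_succ_iff a hF).1 hi
  have h2 := integral_map (μ := markovChainLaw κ ν)
    (φ := fun x => (Preorder.frestrictLe (π := fun _ : ℕ => E) a x, x (a + 1)))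
    (by fun_prop) hF.aestronglyMeasurable
  rw [← h2, ← markovChainLaw_compProd, Measure.integral_compProd h1,
    integral_map (by fun_prop)]
  · rfl
  · exact (hF.stronglyMeasurable.integral_kernel_prod_right'
      (κ := historyKernel κ a)).aestronglyMeasurable

namespace IsLyapunov

variable {V : E → ℝ} {γ K : ℝ} (hV : IsLyapunov κ V γ K)
include hV

/-- Iterating `m ↦ γ m + K` adds at most its fixed point `K / (1 - γ)` to the initial moment, so the
bound is uniform in time. -/
theorem integrable_markovChainLaw (hν : Integrable V ν) (t : ℕ) :
    Integrable (fun x => V (x t)) (markovChainLaw κ ν) ∧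
      ∫ x, V (x t) ∂markovChainLaw κ ν ≤ ∫ x, V x ∂ν + K / (1 - γ) := by
  have hγ : 0 < 1 - γ := by linarith [hV.rate_lt_one]
  induction t with
  | zero =>
    have h0 := markovChainLaw_map_zero (κ := κ) ν
    have hm0 : AEMeasurable (fun x : ℕ → E => x 0) (markovChainLaw κ ν) :=
      (measurable_pi_apply 0).aemeasurable
    rw [← h0, integrable_map_measure hV.measurable.aestronglyMeasurable hm0] at hν
    refine ⟨hν, ?_⟩
    have h1 : ∫ x, V (x 0) ∂markovChainLaw κ ν = ∫ x, V x ∂ν := by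
      conv_rhs => rw [← h0]
      rw [integral_map hm0 hV.measurable.aestronglyMeasurable]
    rw [h1]
    linarith [div_nonneg hV.const_nonneg hγ.le]
  | succ t ih =>
    have hF : Measurable fun p : (Finset.Iic t → E) × E => V p.2 := hV.measurable.comp measurable_snd
    have hdom : Integrable (fun x => γ * V (x t) + K) (markovChainLaw κ ν) :=
      (ih.1.const_mul γ).add (integrable_const K)
    have hPV : Integrable (fun x => transOp κ V (x t)) (markovChainLaw κ ν) := by
      refine hdom.mono' ((measurable_transOp hV.measurable).comp
        (measurable_pi_apply t)).aestronglyMeasurable (ae_of_all _ fun x => ?_)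
      rw [Real.norm_eq_abs, abs_of_nonneg]
      · exact hV.drift _
      · exact integral_nonneg fun y => zero_le_one.trans (hV.one_le y)
    have hi : Integrable (fun x => V (x (t + 1))) (markovChainLaw κ ν) := by
      refine (integrable_markovChainLaw_succ_iff t hF).2 ?_
      rw [Measure.integrable_compProd_iff hF.aestronglyMeasurable]
      refine ⟨ae_of_all _ fun h => hV.integrable _, ?_⟩
      rw [integrable_map_measure
        (hF.norm.stronglyMeasurable.integral_kernel_prod_right'
          (κ := historyKernel κ t)).aestronglyMeasurable (by fun_prop)]
      refine hPV.congr (ae_of_all _ fun x => ?_)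
      refine integral_congr_ae (ae_of_all _ fun y => ?_)
      simp only [Real.norm_eq_abs]
      rw [abs_of_nonneg (zero_le_one.trans (hV.one_le y))]
    refine ⟨hi, ?_⟩
    rw [integral_markovChainLaw_succ t hF hi]
    calc ∫ x, transOp κ V (x t) ∂markovChainLaw κ ν
        ≤ ∫ x, (γ * V (x t) + K) ∂markovChainLaw κ ν :=
          integral_mono hPV hdom fun x => hV.drift _
      _ = γ * ∫ x, V (x t) ∂markovChainLaw κ ν + K := by
          rw [integral_add (ih.1.const_mul γ) (integrable_const K), integral_const_mul]; simp
      _ ≤ γ * (∫ x, V x ∂ν + K / (1 - γ)) + K := by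
          gcongr
          · exact hV.rate_nonneg
          · exact ih.2
      _ = γ * ∫ x, V x ∂ν + K / (1 - γ) := by field_simp; ring
      _ ≤ ∫ x, V x ∂ν + K / (1 - γ) := by
          have : 0 ≤ ∫ x, V x ∂ν := integral_nonneg fun y => zero_le_one.trans (hV.one_le y)
          nlinarith [hV.rate_lt_one]

end IsLyapunov

section SecondMoment

variable {V : E → ℝ} {γ K γ₂ K₂ : ℝ} (hV : IsLyapunov κ V γ K)
  (hV2 : IsLyapunov κ (fun x => V x ^ 2) γ₂ K₂) (hν : Integrable (fun x => V x ^ 2) ν)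
  {f : E → ℝ} (hf : Measurable f) {A : ℝ} (hA0 : 0 ≤ A) (hA : ∀ x, |f x| ≤ A * V x)
include hV hV2 hν hf hA0 hA

theorem memLp_mdiff (t : ℕ) :
    MemLp (mdiff κ f t) 2 (markovChainLaw κ ν) := by
  have h : ∀ s, MemLp (fun x : ℕ → E => V (x s)) 2 (markovChainLaw κ ν) := fun s =>
    (memLp_two_iff_integrable_sq
      (hV.measurable.comp (measurable_pi_apply s)).aestronglyMeasurable).2
      (hV2.integrable_markovChainLaw hν s).1
  refine MemLp.sub ?_ ?_
  · refine ((h (t + 1)).const_mul A).mono' (hf.comp (measurable_pi_apply _)).aestronglyMeasurable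
      (ae_of_all _ fun x => hA _)
  · refine ((h t).const_mul (A * (γ + K))).mono'
      ((measurable_transOp hf).comp (measurable_pi_apply _)).aestronglyMeasurable
      (ae_of_all _ fun x => hV.abs_transOp_le_mul hA0 hA _)

theorem exists_integral_mdiff_sq_le :
    ∃ C, 0 ≤ C ∧ ∀ t, ∫ x, mdiff κ f t x ^ 2 ∂markovChainLaw κ ν ≤ C := by
  set B := ∫ x, V x ^ 2 ∂ν + K₂ / (1 - γ₂)
  have hB : 0 ≤ B := add_nonneg (integral_nonneg fun _ => sq_nonneg _)
    (div_nonneg hV2.const_nonneg (by linarith [hV2.rate_lt_one]))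
  refine ⟨2 * A ^ 2 * B + 2 * (A * (γ + K)) ^ 2 * B, by positivity, fun t => ?_⟩
  have h1 := hV2.integrable_markovChainLaw hν (t + 1)
  have h2 := hV2.integrable_markovChainLaw hν t
  calc ∫ x, mdiff κ f t x ^ 2 ∂markovChainLaw κ ν
      ≤ ∫ x, (2 * A ^ 2 * V (x (t + 1)) ^ 2 + 2 * (A * (γ + K)) ^ 2 * V (x t) ^ 2)
          ∂markovChainLaw κ ν := by
        refine integral_mono (memLp_mdiff hV hV2 hν hf hA0 hA t).integrable_sq
          ((h1.1.const_mul _).add (h2.1.const_mul _)) fun x => ?_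
        have e1 : f (x (t + 1)) ^ 2 ≤ (A * V (x (t + 1))) ^ 2 := sq_le_sq' (by
          linarith [neg_abs_le (f (x (t + 1))), hA (x (t + 1))]) ((le_abs_self _).trans (hA _))
        have e := hV.abs_transOp_le_mul hA0 hA (x t)
        have e2 : transOp κ f (x t) ^ 2 ≤ (A * (γ + K) * V (x t)) ^ 2 := sq_le_sq' (by
          linarith [neg_abs_le (transOp κ f (x t))]) ((le_abs_self _).trans e)
        simp only [mdiff]
        nlinarith [sq_nonneg (f (x (t + 1)) + transOp κ f (x t))]
    _ = 2 * A ^ 2 * ∫ x, V (x (t + 1)) ^ 2 ∂markovChainLaw κ ν +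
        2 * (A * (γ + K)) ^ 2 * ∫ x, V (x t) ^ 2 ∂markovChainLaw κ ν := by
        rw [integral_add (h1.1.const_mul _) (h2.1.const_mul _), integral_const_mul,
          integral_const_mul]
    _ ≤ _ := by
        gcongr
        · exact h1.2
        · exact h2.2

/-- As `s + 1 ≤ t`, the earlier difference is a function of the history up to `t`, and given that
history the later one has mean zero. -/
theorem integral_mdiff_mul_mdiff {s t : ℕ} (hst : s < t) :
    ∫ x, mdiff κ f s x * mdiff κ f t x ∂markovChainLaw κ ν = 0 := by
  let F : (Finset.Iic t → E) × E → ℝ := fun p =>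
    (f (p.1 ⟨s + 1, Finset.mem_Iic.2 hst⟩) - transOp κ f (p.1 ⟨s, Finset.mem_Iic.2 hst.le⟩)) *
      (f p.2 - transOp κ f (p.1 ⟨t, Finset.mem_Iic.2 le_rfl⟩))
  have hTm := measurable_transOp (κ := κ) hf
  have hF : Measurable F := by fun_prop
  have hi : Integrable (fun x => mdiff κ f s x * mdiff κ f t x) (markovChainLaw κ ν) :=
    (memLp_mdiff hV hV2 hν hf hA0 hA s).integrable_mul (memLp_mdiff hV hV2 hν hf hA0 hA t)
  refine (integral_markovChainLaw_succ t hF hi).trans ?_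
  refine integral_eq_zero_of_ae (ae_of_all _ fun x => ?_)
  change ∫ y, mdiff κ f s x * (f y - transOp κ f (x t)) ∂κ (x t) = 0
  rw [integral_const_mul, integral_sub (hV.integrable_of_abs_le_mul hf hA _) (integrable_const _)]
  simp [transOp]

theorem exists_integral_sum_mdiff_sq_le :
    ∃ C, 0 ≤ C ∧ ∀ n : ℕ,
      ∫ x, (∑ t ∈ Finset.range n, mdiff κ f t x) ^ 2 ∂markovChainLaw κ ν ≤ C * n := by
  obtain ⟨C, hC0, hC⟩ := exists_integral_mdiff_sq_le hV hV2 hν hf hA0 hA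
  refine ⟨C, hC0, fun n => ?_⟩
  have hL := memLp_mdiff hV hV2 hν hf hA0 hA
  induction n with
  | zero => simp
  | succ n ih =>
    have hM : MemLp (fun x => ∑ t ∈ Finset.range n, mdiff κ f t x) 2 (markovChainLaw κ ν) :=
      memLp_finsetSum _ fun t _ => hL t
    have hcross : ∫ x, (∑ t ∈ Finset.range n, mdiff κ f t x) * mdiff κ f n x
        ∂markovChainLaw κ ν = 0 := by
      have hi : ∀ t, Integrable (fun x => mdiff κ f t x * mdiff κ f n x) (markovChainLaw κ ν) :=
        fun t => (hL t).integrable_mul (hL n)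
      simp_rw [Finset.sum_mul]
      rw [integral_finsetSum _ fun t _ => hi t]
      exact Finset.sum_eq_zero fun t ht =>
        integral_mdiff_mul_mdiff hV hV2 hν hf hA0 hA (Finset.mem_range.1 ht)
    have hexp : ∀ x, (∑ t ∈ Finset.range (n + 1), mdiff κ f t x) ^ 2 =
        (∑ t ∈ Finset.range n, mdiff κ f t x) ^ 2 +
          2 * ((∑ t ∈ Finset.range n, mdiff κ f t x) * mdiff κ f n x) + mdiff κ f n x ^ 2 := by
      intro x; rw [Finset.sum_range_succ]; ring
    simp_rw [hexp]
    have hc : Integrable (fun x => (∑ t ∈ Finset.range n, mdiff κ f t x) * mdiff κ f n x)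
      (markovChainLaw κ ν) := hM.integrable_mul (hL n)
    have h12 : Integrable (fun x => (∑ t ∈ Finset.range n, mdiff κ f t x) ^ 2 +
        2 * ((∑ t ∈ Finset.range n, mdiff κ f t x) * mdiff κ f n x)) (markovChainLaw κ ν) :=
      hM.integrable_sq.add (hc.const_mul 2)
    rw [integral_add h12 (hL n).integrable_sq,
      integral_add hM.integrable_sq (hc.const_mul 2), integral_const_mul, hcross]
    push_cast
    linarith [hC n]

/-- Orthogonality makes the second moment of the sum of `n` differences at most `C n`. Along `n = (k
+ 1) ^ 2` the averages have second moments at most `C / (k + 1) ^ 2`; these are summable, so the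
squared averages have an almost surely finite sum. Along all `n` the bound `C / n` would not be
summable. -/
theorem ae_tendsto_sum_mdiff_sq :
    ∀ᵐ x ∂markovChainLaw κ ν, Tendsto
      (fun k : ℕ => (∑ t ∈ Finset.range ((k + 1) ^ 2), mdiff κ f t x) / ((k : ℝ) + 1) ^ 2)
      atTop (𝓝 0) := by
  obtain ⟨C, hC0, hC⟩ := exists_integral_sum_mdiff_sq_le hV hV2 hν hf hA0 hA
  have hL := memLp_mdiff hV hV2 hν hf hA0 hA
  set U : ℕ → (ℕ → E) → ℝ := fun k x =>
    (∑ t ∈ Finset.range ((k + 1) ^ 2), mdiff κ f t x) / ((k : ℝ) + 1) ^ 2 with hU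
  have hUm : ∀ k, Measurable (U k) := fun k =>
    (Finset.measurable_sum _ fun t _ => measurable_mdiff hf t).div_const _
  have hUi : ∀ k, Integrable (fun x => U k x ^ 2) (markovChainLaw κ ν) := fun k => by
    simp only [hU, div_pow]
    exact (memLp_finsetSum _ fun t _ => hL t).integrable_sq.div_const _
  have hle : ∀ k, ∫ x, U k x ^ 2 ∂markovChainLaw κ ν ≤ C * (1 / ((k : ℝ) + 1) ^ 2) := by
    intro k
    simp only [hU, div_pow]
    rw [integral_div, div_le_iff₀ (by positivity)]
    refine (hC _).trans (le_of_eq ?_)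
    push_cast
    field_simp
  have hsum : Summable fun k : ℕ => C * (1 / ((k : ℝ) + 1) ^ 2) := by
    refine Summable.mul_left C ?_
    have := (summable_nat_add_iff 1).2 (Real.summable_one_div_nat_pow.2 one_lt_two)
    simpa using this
  have hfin : ∫⁻ x, ∑' k, ENNReal.ofReal (U k x ^ 2) ∂markovChainLaw κ ν ≠ ∞ := by
    rw [lintegral_tsum fun k => ((hUm k).pow_const 2).ennreal_ofReal.aemeasurable]
    refine ne_top_of_le_ne_top hsum.tsum_ofReal_ne_top (ENNReal.tsum_le_tsum fun k => ?_)
    rw [← ofReal_integral_eq_lintegral_ofReal (hUi k) (ae_of_all _ fun _ => sq_nonneg _)]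
    exact ENNReal.ofReal_le_ofReal (hle k)
  have hae := ae_lt_top' (Measurable.aemeasurable
    (Measurable.tsum fun k => ((hUm k).pow_const 2).ennreal_ofReal)) hfin
  filter_upwards [hae] with x hx
  have h1 := ENNReal.tendsto_atTop_zero_of_tsum_ne_top hx.ne
  have h2 := (ENNReal.tendsto_toReal ENNReal.zero_ne_top).comp h1
  have h3 : Tendsto (fun k => U k x ^ 2) atTop (𝓝 0) := by
    refine h2.congr fun k => ?_
    simp [ENNReal.toReal_ofReal (sq_nonneg (U k x))]
  have h4 := h3.sqrt
  rw [Real.sqrt_zero] at h4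
  rw [tendsto_zero_iff_abs_tendsto_zero]
  exact h4.congr fun k => Real.sqrt_sq_eq_abs _

end SecondMoment

end Martingale

/-! ### The strong law of large numbers for bounded observables. -/

section StrongLaw

theorem le_four_mul_of_le_on_squares {S : ℕ → ℝ} (hS : Monotone S) {B : ℝ} (hB : 0 ≤ B)
    (h : ∀ k : ℕ, S ((k + 1) ^ 2) ≤ B * ((k : ℝ) + 1) ^ 2) {n : ℕ} (hn : 1 ≤ n) :
    S n ≤ 4 * B * n := by
  have h1 : n ≤ (Nat.sqrt n + 1) ^ 2 := by
    have := Nat.lt_succ_sqrt n; simp only [Nat.succ_eq_add_one] at this; nlinarith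
  have h0 : 1 ≤ Nat.sqrt n := Nat.sqrt_pos.2 hn
  have h2 : (Nat.sqrt n + 1) ^ 2 ≤ 4 * n := by
    have := Nat.sqrt_le n; nlinarith
  have h3 : ((Nat.sqrt n : ℝ) + 1) ^ 2 ≤ 4 * n := by exact_mod_cast h2
  calc S n ≤ S ((Nat.sqrt n + 1) ^ 2) := hS h1
    _ ≤ B * ((Nat.sqrt n : ℝ) + 1) ^ 2 := h _
    _ ≤ B * (4 * n) := by gcongr
    _ = _ := by ring

/-- Between consecutive squares there are at most `2 (k + 1)` further terms, each bounded by `b`,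
which is negligible against `(k + 1) ^ 2`. -/
theorem tendsto_div_of_tendsto_squares {D : ℕ → ℝ} {b : ℝ} (hD : ∀ t, |D t| ≤ b)
    (h : Tendsto (fun k : ℕ => (∑ t ∈ Finset.range ((k + 1) ^ 2), D t) / ((k : ℝ) + 1) ^ 2)
      atTop (𝓝 0)) :
    Tendsto (fun n : ℕ => (∑ t ∈ Finset.range n, D t) / n) atTop (𝓝 0) := by
  have hb : 0 ≤ b := (abs_nonneg _).trans (hD 0)
  have hsq : Tendsto (fun n : ℕ => Nat.sqrt n - 1) atTop atTop := by
    refine tendsto_atTop.2 fun m => ?_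
    filter_upwards [eventually_ge_atTop ((m + 1) ^ 2)] with n hn
    have : m + 1 ≤ Nat.sqrt n := Nat.le_sqrt'.2 hn
    omega
  have h1 := (h.abs.comp hsq)
  have h2 : Tendsto (fun k : ℕ => 2 * b * (1 / ((k : ℝ) + 1))) atTop (𝓝 (2 * b * 0)) :=
    tendsto_one_div_add_atTop_nhds_zero_nat.const_mul _
  have h3 := h1.add (h2.comp hsq)
  simp only [abs_zero, mul_zero, add_zero] at h3
  refine squeeze_zero_norm' ?_ h3
  filter_upwards [eventually_ge_atTop 1] with n hn
  obtain ⟨k, hk⟩ : ∃ k, Nat.sqrt n = k + 1 :=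
    ⟨Nat.sqrt n - 1, by have : 1 ≤ Nat.sqrt n := Nat.sqrt_pos.2 hn; omega⟩
  have hle : (k + 1) ^ 2 ≤ n := by rw [← hk]; exact Nat.sqrt_le' n
  have hge : n ≤ (k + 1) ^ 2 + 2 * (k + 1) := by
    have := Nat.sqrt_le_add n; rw [hk] at this; nlinarith
  have hle' : ((k : ℝ) + 1) ^ 2 ≤ n := by exact_mod_cast hle
  have hge' : (n : ℝ) ≤ ((k : ℝ) + 1) ^ 2 + 2 * (k + 1) := by exact_mod_cast hge
  simp only [Function.comp_apply, hk, Nat.add_sub_cancel, Real.norm_eq_abs]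
  have hsplit : ∑ t ∈ Finset.range n, D t = ∑ t ∈ Finset.range ((k + 1) ^ 2), D t +
      ∑ t ∈ Finset.Ico ((k + 1) ^ 2) n, D t := (Finset.sum_range_add_sum_Ico _ hle).symm
  have htail : |∑ t ∈ Finset.Ico ((k + 1) ^ 2) n, D t| ≤ b * (2 * ((k : ℝ) + 1)) := by
    calc |∑ t ∈ Finset.Ico ((k + 1) ^ 2) n, D t|
        ≤ ∑ t ∈ Finset.Ico ((k + 1) ^ 2) n, |D t| := Finset.abs_sum_le_sum_abs _ _
      _ ≤ ∑ t ∈ Finset.Ico ((k + 1) ^ 2) n, b := Finset.sum_le_sum fun t _ => hD t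
      _ = ((n : ℝ) - ((k : ℝ) + 1) ^ 2) * b := by
          rw [Finset.sum_const, Nat.card_Ico, nsmul_eq_mul, Nat.cast_sub hle]; push_cast; rfl
      _ ≤ _ := by rw [mul_comm]; gcongr; linarith
  have hk0 : (0 : ℝ) < ((k : ℝ) + 1) ^ 2 := by positivity
  rw [abs_div, abs_div, abs_of_nonneg (Nat.cast_nonneg (α := ℝ) n), abs_of_pos hk0]
  calc |∑ t ∈ Finset.range n, D t| / n
      ≤ (|∑ t ∈ Finset.range ((k + 1) ^ 2), D t| + b * (2 * ((k : ℝ) + 1))) / n := by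
        gcongr; rw [hsplit]; exact (abs_add_le _ _).trans (by gcongr)
    _ ≤ (|∑ t ∈ Finset.range ((k + 1) ^ 2), D t| + b * (2 * ((k : ℝ) + 1))) / ((k : ℝ) + 1) ^ 2 := by
        gcongr
    _ = _ := by field_simp

variable {E : Type*} [MeasurableSpace E] {κ : Kernel E E} [IsMarkovKernel κ]
  {V : E → ℝ} {γ K γ₂ K₂ : ℝ} (hV : IsLyapunov κ V γ K)
  (hV2 : IsLyapunov κ (fun x => V x ^ 2) γ₂ K₂)
include hV hV2

/-- Summing the drift inequality bounds `(1 - γ) ∑ V` by `n K + V (x 0)` plus the martingale of `V`.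
Since `V` is unbounded the martingale is controlled only along squares, but the sums of `V` are
monotone and `(√n + 1) ^ 2 ≤ 4 n`, so this suffices. -/
theorem ae_exists_sum_le_of_integrable {ν : Measure E} [IsProbabilityMeasure ν]
    (hν : Integrable (fun x => V x ^ 2) ν) :
    ∀ᵐ x ∂markovChainLaw κ ν, ∃ B : ℝ, 0 ≤ B ∧
      ∀ n : ℕ, ∑ t ∈ Finset.range n, V (x t) ≤ B * n := by
  have h := ae_tendsto_sum_mdiff_sq hV hV2 hν hV.measurable zero_le_one (A := 1) fun x => by
    rw [one_mul, abs_of_nonneg (zero_le_one.trans (hV.one_le x))]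
  filter_upwards [h] with x hx
  have hγ : 0 < 1 - γ := by linarith [hV.rate_lt_one]
  have hV0 : ∀ y, 0 ≤ V y := fun y => zero_le_one.trans (hV.one_le y)
  obtain ⟨M, hM⟩ := hx.bddAbove_range
  have hM : ∀ k : ℕ, (∑ t ∈ Finset.range ((k + 1) ^ 2), mdiff κ V t x) ≤
      |M| * ((k : ℝ) + 1) ^ 2 := fun k => by
    have := (hM ⟨k, rfl⟩).trans (le_abs_self M)
    simpa only [div_le_iff₀ (show (0 : ℝ) < ((k : ℝ) + 1) ^ 2 by positivity)] using this
  have hbound : ∀ n : ℕ, (1 - γ) * ∑ t ∈ Finset.range n, V (x t) ≤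
      n * K + V (x 0) + ∑ t ∈ Finset.range n, mdiff κ V t x := by
    intro n
    have h1 : ∑ t ∈ Finset.range n, mdiff κ V t x ≥
        ∑ t ∈ Finset.range n, (V (x (t + 1)) - V (x t) + (1 - γ) * V (x t) - K) :=
      Finset.sum_le_sum fun t _ => by
        have := hV.drift (x t)
        simp only [mdiff]; linarith
    rw [Finset.sum_sub_distrib, Finset.sum_add_distrib, Finset.sum_range_sub (fun t => V (x t)),
      ← Finset.mul_sum, Finset.sum_const, Finset.card_range, nsmul_eq_mul] at h1
    linarith [hV0 (x n)]
  have hmono : Monotone fun n : ℕ => ∑ t ∈ Finset.range n, V (x t) :=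
    monotone_nat_of_le_succ fun n => by
      rw [Finset.sum_range_succ]; linarith [hV0 (x n)]
  set B := (K + V (x 0) + |M|) / (1 - γ) with hBdef
  have hB : 0 ≤ B := div_nonneg (add_nonneg (add_nonneg hV.const_nonneg (hV0 _)) (abs_nonneg _))
    hγ.le
  refine ⟨4 * B, by positivity, fun n => ?_⟩
  rcases Nat.eq_zero_or_pos n with rfl | hn
  · simp
  refine le_four_mul_of_le_on_squares hmono hB (fun k => ?_) hn
  have h1 := hbound ((k + 1) ^ 2)
  have h2 := hM k
  have h3 : V (x 0) ≤ V (x 0) * ((k : ℝ) + 1) ^ 2 := by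
    refine le_mul_of_one_le_right (hV0 _) (one_le_pow₀ ?_)
    linarith [(Nat.cast_nonneg k : (0 : ℝ) ≤ k)]
  rw [hBdef, div_mul_eq_mul_div, le_div_iff₀ hγ]
  push_cast at h1
  nlinarith

theorem ae_tendsto_average_of_integrable {ν : Measure E} [IsProbabilityMeasure ν]
    (hν : Integrable (fun x => V x ^ 2) ν) {f : E → ℝ} (hf : Measurable f) {b : ℝ}
    (hb : ∀ x, |f x| ≤ b) {m : ℝ}
    (hm : ∀ ε > 0, ∃ j : ℕ, ∀ x, |(transOp κ)^[j] f x - m| ≤ ε * V x) :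
    ∀ᵐ x ∂markovChainLaw κ ν,
      Tendsto (fun n : ℕ => (∑ t ∈ Finset.range n, f (x t)) / n) atTop (𝓝 m) := by
  have hfm := measurable_iterate_transOp (κ := κ) hf
  have hfb := abs_iterate_transOp_le (κ := κ) hb
  have hmart : ∀ j, ∀ᵐ x ∂markovChainLaw κ ν, Tendsto
      (fun n : ℕ => (∑ t ∈ Finset.range n, mdiff κ ((transOp κ)^[j] f) t x) / n)
      atTop (𝓝 0) := by
    intro j
    have h := ae_tendsto_sum_mdiff_sq hV hV2 hν (hfm j) (abs_nonneg b) fun x =>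
      (hfb j x).trans ((le_abs_self b).trans (le_mul_of_one_le_right (abs_nonneg b) (hV.one_le x)))
    filter_upwards [h] with x hx
    refine tendsto_div_of_tendsto_squares (b := b + b) (fun t => ?_) hx
    exact (abs_sub _ _).trans (add_le_add (hfb j _) (abs_transOp_le (hfb j) _))
  filter_upwards [ae_all_iff.2 hmart, ae_exists_sum_le_of_integrable hV hV2 hν] with x hx hB
  obtain ⟨B, hB0, hB⟩ := hB
  -- With `g = κ^j f`, the sums of `g` and of `κ g` differ by the martingale sum and the boundary
  -- term `g (x n) - g (x 0)`, both `o(n)`.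
  have hstep : ∀ j, Tendsto (fun n : ℕ => (∑ t ∈ Finset.range n, f (x t)) / n -
      (∑ t ∈ Finset.range n, (transOp κ)^[j] f (x t)) / n) atTop (𝓝 0) := by
    intro j
    induction j with
    | zero => simp
    | succ j ih =>
      have hend : Tendsto (fun n : ℕ => ((transOp κ)^[j] f (x n) - (transOp κ)^[j] f (x 0)) / n)
          atTop (𝓝 0) := by
        refine squeeze_zero_norm (a := fun n : ℕ => (b + b) / n) (fun n => ?_)
          (tendsto_const_div_atTop_nhds_zero_nat _)
        rw [norm_div, Real.norm_natCast]
        gcongr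
        exact (abs_sub _ _).trans (add_le_add (hfb j _) (hfb j _))
      have := ih.add ((hx j).sub hend)
      simp only [sub_zero, add_zero] at this
      refine this.congr fun n => ?_
      rw [← Finset.sum_range_sub (fun t => (transOp κ)^[j] f (x t))]
      simp only [mdiff, Finset.sum_sub_distrib, Function.iterate_succ_apply']
      ring
  rw [Metric.tendsto_atTop]
  intro ε hε
  -- Averages of `V` are at most `B`, so this tolerance costs at most `ε / 2`; `B + 1` avoids
  -- division by zero.
  obtain ⟨j, hj⟩ := hm (ε / (2 * (B + 1))) (by positivity)
  obtain ⟨N, hN⟩ := Metric.tendsto_atTop.1 (hstep j) (ε / 2) (by positivity)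
  refine ⟨max N 1, fun n hn => ?_⟩
  have hn0 : (0 : ℝ) < n := by exact_mod_cast (le_max_right N 1).trans hn
  have h1 := hN n ((le_max_left N 1).trans hn)
  rw [Real.dist_eq, sub_zero] at h1
  have h2 : |(∑ t ∈ Finset.range n, (transOp κ)^[j] f (x t)) / n - m| ≤ ε / 2 := by
    have e : (∑ t ∈ Finset.range n, (transOp κ)^[j] f (x t)) / n - m =
        (∑ t ∈ Finset.range n, ((transOp κ)^[j] f (x t) - m)) / n := by
      rw [Finset.sum_sub_distrib]; simp; field_simp
    rw [e, abs_div, abs_of_pos hn0, div_le_iff₀ hn0]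
    calc |∑ t ∈ Finset.range n, ((transOp κ)^[j] f (x t) - m)|
        ≤ ∑ t ∈ Finset.range n, |(transOp κ)^[j] f (x t) - m| := Finset.abs_sum_le_sum_abs _ _
      _ ≤ ∑ t ∈ Finset.range n, ε / (2 * (B + 1)) * V (x t) := Finset.sum_le_sum fun t _ => hj _
      _ = ε / (2 * (B + 1)) * ∑ t ∈ Finset.range n, V (x t) := by rw [Finset.mul_sum]
      _ ≤ ε / (2 * (B + 1)) * ((B + 1) * n) := by
          gcongr
          refine (hB n).trans ?_
          gcongr
          linarith
      _ = ε / 2 * n := by field_simp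
  rw [Real.dist_eq]
  calc _ = |((∑ t ∈ Finset.range n, f (x t)) / n -
          (∑ t ∈ Finset.range n, (transOp κ)^[j] f (x t)) / n) +
          ((∑ t ∈ Finset.range n, (transOp κ)^[j] f (x t)) / n - m)| := by ring_nf
    _ ≤ _ := abs_add_le _ _
    _ < ε := by linarith

omit hV2 [IsMarkovKernel κ] in
-- Reweight `ν` by the strictly positive density `V⁻²` and normalise. This is what removes every
-- moment condition from the initial law.
theorem exists_integrable_absolutelyContinuous (ν : Measure E) [IsProbabilityMeasure ν] :
    ∃ ν' : Measure E, IsProbabilityMeasure ν' ∧ ν ≪ ν' ∧ Integrable (fun x => V x ^ 2) ν' := by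
  have hV0 : ∀ y, 0 < V y := fun y => zero_lt_one.trans_le (hV.one_le y)
  set w : E → ℝ≥0∞ := fun x => ENNReal.ofReal ((V x ^ 2)⁻¹) with hw
  have hwm : Measurable w := (hV.measurable.pow_const 2).inv.ennreal_ofReal
  have hw0 : ∀ x, w x ≠ 0 := fun x => by
    have := hV0 x
    simp only [hw, ne_eq, ENNReal.ofReal_eq_zero, not_le]
    positivity
  have hle : ∀ x, w x ≤ 1 := fun x => by
    rw [hw, ← ENNReal.ofReal_one]
    exact ENNReal.ofReal_le_ofReal (inv_le_one_of_one_le₀ (one_le_pow₀ (hV.one_le x)))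
  set ρ := ν.withDensity w
  have hac : ν ≪ ρ := withDensity_absolutelyContinuous' hwm.aemeasurable (ae_of_all _ hw0)
  have hfin : ρ Set.univ ≠ ∞ := by
    rw [withDensity_apply _ MeasurableSet.univ]
    refine ne_top_of_le_ne_top (b := 1) (by simp) ((lintegral_mono hle).trans ?_)
    simp
  have hne : ρ Set.univ ≠ 0 := fun h0 => by
    have := hac h0
    simp at this
  have : IsFiniteMeasure ρ := ⟨hfin.lt_top⟩
  refine ⟨(ρ Set.univ)⁻¹ • ρ, ⟨by simp [ENNReal.inv_mul_cancel hne hfin]⟩, ?_, ?_⟩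
  · exact hac.trans (Measure.absolutelyContinuous_smul (by simp [hfin]))
  · refine Integrable.smul_measure ?_ (by simp [hne])
    rw [integrable_withDensity_iff hwm (ae_of_all _ fun x => (hle x).trans_lt (by simp))]
    refine (integrable_const (1 : ℝ)).congr (ae_of_all _ fun x => ?_)
    have := hV0 x
    simp only [hw]
    rw [ENNReal.toReal_ofReal (by positivity), mul_inv_cancel₀ (by positivity)]

/-- Averages of a Lyapunov function along almost every trajectory are bounded. -/
theorem ae_exists_sum_le (ν : Measure E) [IsProbabilityMeasure ν] :
    ∀ᵐ x ∂markovChainLaw κ ν, ∃ B : ℝ, 0 ≤ B ∧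
      ∀ n : ℕ, ∑ t ∈ Finset.range n, V (x t) ≤ B * n := by
  obtain ⟨ν', _, hac, hi⟩ := exists_integrable_absolutelyContinuous hV ν
  exact (markovChainLaw_absolutelyContinuous hac).ae_le (ae_exists_sum_le_of_integrable hV hV2 hi)

/-- A strong law of large numbers for Markov chains: if `κ^j f → m` in the `V`-weighted supremum
norm, then the averages of `f` along almost every trajectory converge to `m`. -/
theorem ae_tendsto_average (ν : Measure E) [IsProbabilityMeasure ν] {f : E → ℝ} (hf : Measurable f)
    {b : ℝ} (hb : ∀ x, |f x| ≤ b) {m : ℝ}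
    (hm : ∀ ε > 0, ∃ j : ℕ, ∀ x, |(transOp κ)^[j] f x - m| ≤ ε * V x) :
    ∀ᵐ x ∂markovChainLaw κ ν,
      Tendsto (fun n : ℕ => (∑ t ∈ Finset.range n, f (x t)) / n) atTop (𝓝 m) := by
  obtain ⟨ν', _, hac, hi⟩ := exists_integrable_absolutelyContinuous hV ν
  exact (markovChainLaw_absolutelyContinuous hac).ae_le
    (ae_tendsto_average_of_integrable hV hV2 hi hf hb hm)

end StrongLaw

/-! ### Contraction in a weighted distance. -/

section WeakHarris

theorem integral_sqrt_mul_le {X : Type*} [MeasurableSpace X] {μ : Measure X} {u v : X → ℝ}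
    (hu : ∀ x, 0 ≤ u x) (hv : ∀ x, 0 ≤ v x) (iu : Integrable u μ) (iv : Integrable v μ) :
    ∫ x, √(u x * v x) ∂μ ≤ √((∫ x, u x ∂μ) * ∫ x, v x ∂μ) := by
  have hL : ∀ {w : X → ℝ}, (∀ x, 0 ≤ w x) → Integrable w μ →
      MemLp (fun x => √(w x)) (ENNReal.ofReal 2) μ := by
    intro w hw iw
    have h2 : ENNReal.ofReal 2 = 2 := by norm_num
    rw [h2, memLp_two_iff_integrable_sq iw.aestronglyMeasurable.aemeasurable.sqrt.aestronglyMeasurable]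
    exact iw.congr (ae_of_all _ fun x => (Real.sq_sqrt (hw x)).symm)
  have h := integral_mul_le_Lp_mul_Lq_of_nonneg Real.HolderConjugate.two_two
    (ae_of_all μ fun x => Real.sqrt_nonneg (u x)) (ae_of_all μ fun x => Real.sqrt_nonneg (v x))
    (hL hu iu) (hL hv iv)
  simp only [Real.rpow_two, Real.sq_sqrt (hu _), Real.sq_sqrt (hv _), ← Real.sqrt_eq_rpow] at h
  rw [Real.sqrt_mul (integral_nonneg hu)]
  simpa only [Real.sqrt_mul (hu _)] using h

variable {E : Type*} [MeasurableSpace E]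

/-- The weighted distance-like function `√(d(x,y) (1 + β V(x) + β V(y)))`. -/
noncomputable def weightedDist (d : E → E → ℝ) (V : E → ℝ) (β : ℝ) (x y : E) : ℝ :=
  √(d x y * (1 + β * (V x + V y)))

/-- The kernel `κ` weakly contracts the bounded distance-like function `d`, with respect to the
Lyapunov function `V`: couplings of `κ x` and `κ y` exist that do not expand `d` on average, and
contract it by the factor `q R < 1` when `V x + V y ≤ R`. -/
structure IsWeakContraction [MetricSpace E] (κ : Kernel E E) (V : E → ℝ) (d : E → E → ℝ)
    (q : ℝ → ℝ) : Prop where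
  continuous_dist : Continuous (Function.uncurry d)
  dist_nonneg : ∀ x y, 0 ≤ d x y
  dist_le_one : ∀ x y, d x y ≤ 1
  dist_self : ∀ x, d x x = 0
  exists_min_le : ∃ c : ℝ, ∀ x y, min 1 (dist x y) ≤ c * d x y
  rate_lt_one : ∀ R, q R < 1
  exists_coupling : ∀ x y, ∃ Γ : Measure (E × E), Γ.map Prod.fst = κ x ∧ Γ.map Prod.snd = κ y ∧
    ∫ p, d p.1 p.2 ∂Γ ≤ d x y ∧ ∀ R, V x + V y ≤ R → ∫ p, d p.1 p.2 ∂Γ ≤ q R * d x y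

variable [MetricSpace E] [BorelSpace E] [SecondCountableTopology E]
  {κ : Kernel E E} [IsMarkovKernel κ] {V : E → ℝ} {γ K : ℝ} {d : E → E → ℝ} {q : ℝ → ℝ}

/-- Cauchy–Schwarz under the coupling separates the mean of `d` from the mean of the weight. If `V x
+ V y ≤ R`, the first contracts and the second barely grows; if `V x + V y ≥ R`, the first does not
expand and the drift shrinks the second. -/
theorem IsLyapunov.exists_contraction_weightedDist (hV : IsLyapunov κ V γ K)
    (hd : IsWeakContraction κ V d q) :
    ∃ β α : ℝ, 0 < β ∧ 0 ≤ α ∧ α < 1 ∧ ∀ (f : E → ℝ) (b L : ℝ), Measurable f → (∀ x, |f x| ≤ b) →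
      0 ≤ L → (∀ x y, |f x - f y| ≤ L * weightedDist d V β x y) →
        ∀ x y, |transOp κ f x - transOp κ f y| ≤ α * L * weightedDist d V β x y := by
  have hγ : 0 < 1 - γ := by linarith [hV.rate_lt_one]
  have hγ0 := hV.rate_nonneg
  have hK := hV.const_nonneg
  have hV0 : ∀ y, 0 ≤ V y := fun y => zero_le_one.trans (hV.one_le y)
  -- Above level `R` the constant `2 K` uses at most half of the drift: `γ S + 2 K ≤ (1 + γ) / 2 *
  -- S`.
  set R := 4 * K / (1 - γ) + 1 with hR
  have hR0 : 0 < R := by positivity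
  have hKR : 2 * K ≤ (1 - γ) / 2 * R := by
    rw [hR]; field_simp; nlinarith
  set q₀ := max (q R) 0 with hq₀
  have hq1 : q₀ < 1 := max_lt (hd.rate_lt_one R) one_pos
  have hq0 : 0 ≤ q₀ := le_max_right _ _
  -- Small enough that the growth `2 β K` of the weight spends at most half of the contraction
  -- margin `1 - q₀`.
  set β := (1 - q₀) / (4 * K + 4) with hβ
  have hβ0 : 0 < β := div_pos (by linarith) (by linarith)
  have hβK : 2 * β * K ≤ (1 - q₀) / 2 := by
    rw [hβ, mul_div_assoc', div_mul_eq_mul_div, div_le_div_iff₀ (by linarith) two_pos]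
    nlinarith
  -- The ratio `(1 + β S (1 + γ) / 2) / (1 + β S)` decreases in `S`, so `τ` is its worst value over
  -- `S ≥ R`.
  set τ := (1 + β * R * ((1 + γ) / 2)) / (1 + β * R) with hτ
  have hβR : 0 < β * R := by positivity
  have hτ1 : τ < 1 := by
    rw [hτ, div_lt_one (by linarith)]
    nlinarith
  set α₂ := max ((1 + q₀) / 2) τ with hα₂
  have hα1 : α₂ < 1 := max_lt (by linarith) hτ1
  have hα0 : 0 ≤ α₂ := le_max_of_le_left (by linarith)
  refine ⟨β, √α₂, hβ0, Real.sqrt_nonneg _, by rw [Real.sqrt_lt' one_pos]; simpa using hα1, ?_⟩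
  intro f b L hf hb hL hfL x y
  obtain ⟨Γ, h1, h2, hle, hsmall⟩ := hd.exists_coupling x y
  have : IsProbabilityMeasure Γ := by
    have : IsProbabilityMeasure (Γ.map Prod.fst) := h1 ▸ inferInstance
    exact Measure.isProbabilityMeasure_of_map (μ := Γ) Prod.fst
  have i1 : ∀ {g : E → ℝ}, Measurable g → Integrable g (κ x) → Integrable (fun p => g p.1) Γ :=
    fun hg hi => (integrable_map_measure hg.aestronglyMeasurable measurable_fst.aemeasurable).1
      (h1 ▸ hi)
  have i2 : ∀ {g : E → ℝ}, Measurable g → Integrable g (κ y) → Integrable (fun p => g p.2) Γ :=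
    fun hg hi => (integrable_map_measure hg.aestronglyMeasurable measurable_snd.aemeasurable).1
      (h2 ▸ hi)
  have e1 : ∀ {g : E → ℝ}, Measurable g → transOp κ g x = ∫ p, g p.1 ∂Γ := fun hg => by
    rw [transOp, ← h1, integral_map measurable_fst.aemeasurable hg.aestronglyMeasurable]
  have e2 : ∀ {g : E → ℝ}, Measurable g → transOp κ g y = ∫ p, g p.2 ∂Γ := fun hg => by
    rw [transOp, ← h2, integral_map measurable_snd.aemeasurable hg.aestronglyMeasurable]
  have hdm : Measurable fun p : E × E => d p.1 p.2 := hd.continuous_dist.measurable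
  have hdi : Integrable (fun p : E × E => d p.1 p.2) Γ :=
    Integrable.of_bound hdm.aestronglyMeasurable 1 (ae_of_all _ fun p => by
      rw [Real.norm_eq_abs, abs_of_nonneg (hd.dist_nonneg _ _)]; exact hd.dist_le_one _ _)
  have hVi : Integrable (fun p : E × E => V p.1 + V p.2) Γ :=
    (i1 hV.measurable (hV.integrable x)).add (i2 hV.measurable (hV.integrable y))
  have hWi : Integrable (fun p : E × E => 1 + β * (V p.1 + V p.2)) Γ :=
    (integrable_const _).add (hVi.const_mul β)
  have hW0 : ∀ p : E × E, 0 ≤ 1 + β * (V p.1 + V p.2) := fun p =>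
    add_nonneg zero_le_one (mul_nonneg hβ0.le (add_nonneg (hV0 _) (hV0 _)))
  have hWint : ∫ p, (1 + β * (V p.1 + V p.2)) ∂Γ ≤ 1 + 2 * β * K + γ * β * (V x + V y) := by
    rw [integral_add (integrable_const _) (hVi.const_mul β), integral_const_mul,
      integral_add (i1 hV.measurable (hV.integrable x)) (i2 hV.measurable (hV.integrable y)),
      ← e1 hV.measurable, ← e2 hV.measurable]
    have := hV.drift x
    have := hV.drift y
    simp only [integral_const, probReal_univ, smul_eq_mul, mul_one]
    nlinarith
  have hDi : Integrable (fun p : E × E => weightedDist d V β p.1 p.2) Γ := by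
    refine hWi.mono' ?_ (ae_of_all _ fun p => ?_)
    · exact (hdm.mul (measurable_const.add (measurable_const.mul
        ((hV.measurable.comp measurable_fst).add
          (hV.measurable.comp measurable_snd))))).sqrt.aestronglyMeasurable
    · rw [Real.norm_eq_abs, weightedDist, abs_of_nonneg (Real.sqrt_nonneg _)]
      have hW1 : 1 ≤ 1 + β * (V p.1 + V p.2) :=
        le_add_of_nonneg_right (mul_nonneg hβ0.le (add_nonneg (hV0 _) (hV0 _)))
      refine Real.sqrt_le_iff.2 ⟨hW0 p, ?_⟩
      calc d p.1 p.2 * (1 + β * (V p.1 + V p.2)) ≤ 1 * (1 + β * (V p.1 + V p.2)) :=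
            mul_le_mul_of_nonneg_right (hd.dist_le_one _ _) (hW0 p)
        _ ≤ _ := by rw [one_mul, sq]; exact le_mul_of_one_le_right (hW0 p) hW1
  have hmain : (∫ p, d p.1 p.2 ∂Γ) * ∫ p, (1 + β * (V p.1 + V p.2)) ∂Γ ≤
      α₂ * (d x y * (1 + β * (V x + V y))) := by
    set S := V x + V y
    have hS : 0 ≤ S := add_nonneg (hV0 _) (hV0 _)
    have hId : 0 ≤ ∫ p, d p.1 p.2 ∂Γ := integral_nonneg fun p => hd.dist_nonneg _ _
    have hdxy := hd.dist_nonneg x y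
    have hβS : 0 ≤ β * S := mul_nonneg hβ0.le hS
    refine (mul_le_mul_of_nonneg_left hWint hId).trans ?_
    have hpos : 0 ≤ 1 + 2 * β * K + γ * β * S := by positivity
    rcases le_total S R with h | h
    · have hc : ∫ p, d p.1 p.2 ∂Γ ≤ q₀ * d x y :=
        (hsmall R h).trans (mul_le_mul_of_nonneg_right (le_max_left _ _) hdxy)
      calc _ ≤ q₀ * d x y * (1 + 2 * β * K + γ * β * S) := mul_le_mul_of_nonneg_right hc hpos
        _ ≤ q₀ * d x y * ((1 + 2 * β * K) * (1 + β * S)) := by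
            gcongr
            have h3 : 0 ≤ (1 - γ) * (β * S) := mul_nonneg hγ.le hβS
            have h4 : 0 ≤ 2 * β * K * (β * S) := by positivity
            linarith
        _ = q₀ * (1 + 2 * β * K) * (d x y * (1 + β * S)) := by ring
        _ ≤ α₂ * (d x y * (1 + β * S)) := by
            refine mul_le_mul_of_nonneg_right ?_ (mul_nonneg hdxy (by linarith))
            refine le_trans ?_ (le_max_left _ _)
            have : q₀ * (2 * β * K) ≤ 1 * (2 * β * K) :=
              mul_le_mul_of_nonneg_right hq1.le (by positivity)
            linarith
    · calc _ ≤ d x y * (1 + 2 * β * K + γ * β * S) := mul_le_mul_of_nonneg_right hle hpos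
        _ ≤ d x y * (τ * (1 + β * S)) := by
            gcongr
            rw [hτ, div_mul_eq_mul_div, le_div_iff₀ (by linarith)]
            have h5 : 2 * K ≤ (1 - γ) / 2 * S := hKR.trans (by gcongr)
            have h6 : 1 + 2 * β * K + γ * β * S ≤ 1 + β * S * ((1 + γ) / 2) := by nlinarith
            have h7 : 0 ≤ (β * S - β * R) * ((1 - γ) / 2) :=
              mul_nonneg (by nlinarith) (by linarith)
            nlinarith [mul_le_mul_of_nonneg_right h6 (show 0 ≤ 1 + β * R by linarith)]
        _ ≤ d x y * (α₂ * (1 + β * S)) := by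
            gcongr
            exact le_max_right _ _
        _ = _ := by ring
  have hfi := integrable_of_abs_le (ρ := κ x) hf hb
  have hfi' := integrable_of_abs_le (ρ := κ y) hf hb
  rw [e1 hf, e2 hf, ← integral_sub (i1 hf hfi) (i2 hf hfi')]
  calc |∫ p, (f p.1 - f p.2) ∂Γ| ≤ ∫ p, L * weightedDist d V β p.1 p.2 ∂Γ :=
        norm_integral_le_of_norm_le (f := fun p : E × E => f p.1 - f p.2) (hDi.const_mul L)
          (ae_of_all _ fun p => hfL _ _)
    _ = L * ∫ p, weightedDist d V β p.1 p.2 ∂Γ := integral_const_mul _ _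
    _ ≤ L * √((∫ p, d p.1 p.2 ∂Γ) * ∫ p, (1 + β * (V p.1 + V p.2)) ∂Γ) := by
        gcongr
        exact integral_sqrt_mul_le (fun p => hd.dist_nonneg _ _) hW0 hdi hWi
    _ ≤ L * √(α₂ * (d x y * (1 + β * (V x + V y)))) := by gcongr
    _ = _ := by rw [Real.sqrt_mul hα0, weightedDist]; ring

end WeakHarris

/-! ### Existence, uniqueness and attraction of the invariant measure. -/

section InvariantMeasure

theorem exists_abs_le_of_dist_le {E : Type*} [Nonempty E] {f : E → ℝ}
    (hb : ∃ C : ℝ, ∀ x y, dist (f x) (f y) ≤ C) : ∃ b, ∀ x, |f x| ≤ b := by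
  obtain ⟨C, hC⟩ := hb
  obtain ⟨x₀⟩ := ‹Nonempty E›
  refine ⟨C + |f x₀|, fun x => ?_⟩
  have := hC x x₀
  rw [Real.dist_eq] at this
  have h2 := abs_add_le (f x - f x₀) (f x₀)
  rw [sub_add_cancel] at h2
  linarith

variable {E : Type*} [MetricSpace E] [MeasurableSpace E] [BorelSpace E]

/-- Probability measures that integrate bounded Lipschitz functions alike are equal. -/
theorem MeasureTheory.ProbabilityMeasure.ext_of_forall_lipschitz {μ μ' : ProbabilityMeasure E}
    (h : ∀ f : E → ℝ, (∃ C : ℝ, ∀ x y, dist (f x) (f y) ≤ C) → (∃ L, LipschitzWith L f) →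
      ∫ x, f x ∂(μ : Measure E) = ∫ x, f x ∂(μ' : Measure E)) : μ = μ' := by
  have h1 : Tendsto (fun _ : ℕ => μ) atTop (𝓝 μ') :=
    tendsto_iff_forall_lipschitz_integral_tendsto.2 fun f hb hL => by
      rw [h f hb hL]; exact tendsto_const_nhds
  exact tendsto_nhds_unique tendsto_const_nhds h1

variable {κ : Kernel E E} [IsMarkovKernel κ] {V : E → ℝ} {γ K : ℝ} {d : E → E → ℝ} {q : ℝ → ℝ}

omit [MetricSpace E] [BorelSpace E] in
theorem integral_bind_eq_integral_transOp {μ : Measure E} [IsProbabilityMeasure μ] {f : E → ℝ}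
    (hf : Measurable f) {b : ℝ} (hb : ∀ x, |f x| ≤ b) :
    ∫ x, f x ∂(μ.bind κ) = ∫ x, transOp κ f x ∂μ := by
  have : IsProbabilityMeasure (μ.bind κ) :=
    inferInstanceAs (IsProbabilityMeasure (κ ∘ₘ μ))
  have hi : Integrable f (μ.bind κ) := integrable_of_abs_le hf hb
  rw [Measure.comp_eq_comp_const_apply] at hi ⊢
  rw [Kernel.integral_comp hi]
  rfl

omit [MetricSpace E] [BorelSpace E] in
theorem ProbabilityTheory.Kernel.Invariant.integral_iterate_transOp {μ : Measure E}
    [IsProbabilityMeasure μ] (h : κ.Invariant μ) {f : E → ℝ} (hf : Measurable f) {b : ℝ}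
    (hb : ∀ x, |f x| ≤ b) (j : ℕ) : ∫ x, (transOp κ)^[j] f x ∂μ = ∫ x, f x ∂μ := by
  induction j with
  | zero => rfl
  | succ j ih =>
    rw [Function.iterate_succ_apply', ← integral_bind_eq_integral_transOp
      (measurable_iterate_transOp hf j) (abs_iterate_transOp_le hb j), h.def, ih]

omit [BorelSpace E] [IsMarkovKernel κ] in
theorem IsLyapunov.weightedDist_le (hV : IsLyapunov κ V γ K) (hd : IsWeakContraction κ V d q)
    {β : ℝ} (hβ : 0 < β) (x y : E) : weightedDist d V β x y ≤ 1 + β * (V x + V y) := by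
  have h0 : 0 ≤ β * (V x + V y) := mul_nonneg hβ.le (add_nonneg
    (zero_le_one.trans (hV.one_le x)) (zero_le_one.trans (hV.one_le y)))
  refine Real.sqrt_le_iff.2 ⟨by linarith, ?_⟩
  calc d x y * (1 + β * (V x + V y)) ≤ 1 * (1 + β * (V x + V y)) :=
        mul_le_mul_of_nonneg_right (hd.dist_le_one _ _) (by linarith)
    _ ≤ _ := by nlinarith

omit [BorelSpace E] [IsMarkovKernel κ] in
-- A bounded Lipschitz `f` varies by at most a multiple of `min 1 dist`, hence of `d`; and `d ≤ 1`
-- gives `d² ≤ d`, so the square root in the weighted distance only helps.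
theorem IsLyapunov.exists_abs_sub_le_weightedDist (hV : IsLyapunov κ V γ K)
    (hd : IsWeakContraction κ V d q) {β : ℝ} (hβ : 0 < β) {f : E → ℝ}
    (hb : ∃ C : ℝ, ∀ x y, dist (f x) (f y) ≤ C) (hL : ∃ L, LipschitzWith L f) :
    ∃ L, 0 ≤ L ∧ ∀ x y, |f x - f y| ≤ L * weightedDist d V β x y := by
  obtain ⟨C, hC⟩ := hb
  obtain ⟨L, hL⟩ := hL
  obtain ⟨c, hc⟩ := hd.exists_min_le
  refine ⟨(|C| + L) * |c|, by positivity, fun x y => ?_⟩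
  have hd0 := hd.dist_nonneg x y
  have h1 : |f x - f y| ≤ (|C| + L) * min 1 (dist x y) := by
    rw [← Real.dist_eq]
    rcases le_total 1 (dist x y) with h | h
    · rw [min_eq_left h]
      have := (hC x y).trans (le_abs_self C)
      linarith [L.coe_nonneg]
    · rw [min_eq_right h]
      have := hL.dist_le_mul x y
      nlinarith [abs_nonneg C, dist_nonneg (x := x) (y := y)]
  have h2 : d x y ≤ weightedDist d V β x y := by
    have hW : 0 ≤ β * (V x + V y) := mul_nonneg hβ.le (add_nonneg
      (zero_le_one.trans (hV.one_le x)) (zero_le_one.trans (hV.one_le y)))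
    refine Real.le_sqrt_of_sq_le ?_
    rw [sq]
    exact mul_le_mul_of_nonneg_left (by linarith [hd.dist_le_one x y]) hd0
  calc |f x - f y| ≤ (|C| + L) * min 1 (dist x y) := h1
    _ ≤ (|C| + L) * (|c| * d x y) := by
        gcongr
        exact (hc x y).trans (mul_le_mul_of_nonneg_right (le_abs_self c) hd0)
    _ ≤ (|C| + L) * (|c| * weightedDist d V β x y) := by gcongr
    _ = _ := by ring

variable [SecondCountableTopology E]

/-- **Weak Harris theorem**: a Markov kernel with a Lyapunov function, weakly contracting a bounded
distance-like function, has a unique invariant probability measure, to which its iterates converge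
in the weighted supremum norm when applied to bounded Lipschitz functions. -/
theorem IsLyapunov.exists_invariant [Nonempty E] (hV : IsLyapunov κ V γ K)
    (hd : IsWeakContraction κ V d q) (hVc : Continuous V) (hVK : ∀ R, IsCompact {x | V x ≤ R}) :
    ∃ μ : ProbabilityMeasure E, κ.Invariant (μ : Measure E) ∧ Integrable V (μ : Measure E) ∧
      (∀ μ' : ProbabilityMeasure E, κ.Invariant (μ' : Measure E) → μ' = μ) ∧
      ∀ f : E → ℝ, (∃ C : ℝ, ∀ x y, dist (f x) (f y) ≤ C) → (∃ L, LipschitzWith L f) →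
        ∀ ε > 0, ∃ j : ℕ, ∀ x, |(transOp κ)^[j] f x - ∫ y, f y ∂(μ : Measure E)| ≤ ε * V x := by
  obtain ⟨β, α, hβ, hα0, hα1, hcontr⟩ := hV.exists_contraction_weightedDist hd
  have hV0 : ∀ y, 0 ≤ V y := fun y => zero_le_one.trans (hV.one_le y)
  obtain ⟨x₀⟩ := ‹Nonempty E›
  have : Nonempty E := ⟨x₀⟩
  have hiter : ∀ (f : E → ℝ) (b L : ℝ), Measurable f → (∀ x, |f x| ≤ b) →
      0 ≤ L → (∀ x y, |f x - f y| ≤ L * weightedDist d V β x y) → ∀ j x y,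
        |(transOp κ)^[j] f x - (transOp κ)^[j] f y| ≤ α ^ j * L * weightedDist d V β x y := by
    intro f b L hf hb hL hfL j
    induction j with
    | zero => simpa using hfL
    | succ j ih =>
      intro x y
      rw [Function.iterate_succ_apply', pow_succ', mul_assoc α]
      exact hcontr _ b _ (measurable_iterate_transOp hf j) (abs_iterate_transOp_le hb j)
        (by positivity) ih x y
  -- The laws of the chain started at `x₀` are tight.
  set Q := markovChainLaw κ (Measure.dirac x₀) with hQ
  let ρ : ℕ → ProbabilityMeasure E := fun n =>
    ⟨Q.map (fun x => x n), Measure.isProbabilityMeasure_map (measurable_pi_apply n).aemeasurable⟩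
  have hρint : ∀ {f : E → ℝ} (n : ℕ), Measurable f →
      ∫ x, f x ∂(ρ n : Measure E) = ∫ x, f (x n) ∂Q := fun n hf =>
    integral_map (measurable_pi_apply n).aemeasurable hf.aestronglyMeasurable
  have hVδ : Integrable V (Measure.dirac x₀) :=
    integrable_dirac (by simp)
  set C := ∫ x, V x ∂(Measure.dirac x₀) + K / (1 - γ) with hCdef
  have hmom : ∀ n, Integrable V (ρ n : Measure E) ∧ ∫ x, V x ∂(ρ n : Measure E) ≤ C := fun n => by
    rw [hρint n hV.measurable]
    refine ⟨?_, (hV.integrable_markovChainLaw hVδ n).2⟩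
    exact (integrable_map_measure hV.measurable.aestronglyMeasurable
      (measurable_pi_apply n).aemeasurable).2 (hV.integrable_markovChainLaw hVδ n).1
  -- By Markov's inequality and the uniform moment bound `C`, each law gives mass at most `C / (k +
  -- 1)` to `V > k + 1`, whose complement is compact.
  have hcompact := isCompact_setOfPred_probabilityMeasure_mass_eq_compl_isCompact_le
    (E := E) (u := fun n : ℕ => Real.toNNReal (C * (1 / ((n : ℝ) + 1))))
    (K := fun n : ℕ => {x | V x ≤ n + 1})
    (by
      have h := (tendsto_one_div_add_atTop_nhds_zero_nat (𝕜 := ℝ)).const_mul C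
      rw [mul_zero] at h
      have h' := (continuous_real_toNNReal.tendsto 0).comp h
      rwa [Real.toNNReal_zero] at h')
    (fun n => hVK _) (Or.inl inferInstance)
  have hmem : ∀ n, ρ n ∈ {μ : ProbabilityMeasure E | ∀ k : ℕ,
      μ {x | V x ≤ k + 1}ᶜ ≤ Real.toNNReal (C * (1 / ((k : ℝ) + 1)))} := by
    intro n k
    rw [← NNReal.coe_le_coe]
    refine le_trans ?_ (Real.le_coe_toNNReal _)
    have h1 := mul_meas_ge_le_integral_of_nonneg (ae_of_all _ hV0) (hmom n).1 ((k : ℝ) + 1)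
    have h2 : (ρ n : Measure E).real {x | V x ≤ k + 1}ᶜ ≤
        (ρ n : Measure E).real {x | (k : ℝ) + 1 ≤ V x} :=
      measureReal_mono fun x hx => le_of_lt (by simpa using hx)
    change (ρ n : Measure E).real {x | V x ≤ k + 1}ᶜ ≤ _
    rw [mul_one_div, le_div_iff₀ (by positivity)]
    nlinarith [(hmom n).2, (Nat.cast_nonneg k : (0 : ℝ) ≤ k)]
  -- A free ultrafilter plays the role of a convergent subsequence: compactness provides the limit,
  -- and limits along `atTop` persist along `U`.
  let U : Ultrafilter ℕ := hyperfilter ℕ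
  have hU : (U : Filter ℕ) ≤ atTop := by
    rw [← Nat.cofinite_eq_atTop]; exact hyperfilter_le_cofinite
  obtain ⟨μ, -, hμ⟩ := hcompact.ultrafilter_le_nhds (U.map ρ)
    (le_principal_iff.2 (Ultrafilter.mem_map.2 (univ_mem' hmem)))
  have hμ : Tendsto ρ U (𝓝 μ) := hμ
  have hlim : ∀ {f : E → ℝ} {b : ℝ}, Continuous f → (∀ x, |f x| ≤ b) →
      Tendsto (fun n => ∫ x, f x ∂(ρ n : Measure E)) U (𝓝 (∫ x, f x ∂(μ : Measure E))) := by
    intro f b hf hb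
    exact ProbabilityMeasure.tendsto_iff_forall_integral_tendsto.1 hμ
      (BoundedContinuousFunction.ofNormedAddCommGroup f hf b hb)
  have hρiter : ∀ n (f : E → ℝ) (b : ℝ), Measurable f → (∀ x, |f x| ≤ b) →
      ∫ x, f x ∂(ρ n : Measure E) = (transOp κ)^[n] f x₀ := by
    intro n
    induction n with
    | zero =>
      intro f b hf hb
      have : (ρ 0 : Measure E) = Measure.dirac x₀ := markovChainLaw_map_zero _
      rw [this, integral_dirac]
      rfl
    | succ n ih =>
      intro f b hf hb
      rw [Function.iterate_succ_apply, ← ih _ b (measurable_transOp hf) (abs_transOp_le hb),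
        hρint _ hf, hρint _ (measurable_transOp hf)]
      refine integral_markovChainLaw_succ n (hf.comp measurable_snd) ?_
      exact integrable_of_abs_le (hf.comp (measurable_pi_apply _)) fun x => hb _
  -- The limit integrates the Lyapunov function.
  have hμV : Integrable V (μ : Measure E) := by
    refine ⟨hV.measurable.aestronglyMeasurable, ?_⟩
    -- The moment bound passes to the weak limit for the bounded continuous truncations of `V`, then
    -- to `V` by Fatou.
    have hN : ∀ N : ℕ, ∫⁻ x, ENNReal.ofReal (min (V x) N) ∂(μ : Measure E) ≤ ENNReal.ofReal C := by
      intro N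
      have hmb : ∀ x, |min (V x) N| ≤ N := fun x => by
        rw [abs_of_nonneg (le_min (hV0 x) (Nat.cast_nonneg N))]; exact min_le_right _ _
      have hmc : Continuous fun x => min (V x) (N : ℝ) := hVc.min continuous_const
      rw [← ofReal_integral_eq_lintegral_ofReal (integrable_of_abs_le hmc.measurable hmb)
        (ae_of_all _ fun x => le_min (hV0 x) (Nat.cast_nonneg N))]
      refine ENNReal.ofReal_le_ofReal (le_of_tendsto (hlim hmc hmb) (Eventually.of_forall fun n => ?_))
      exact (integral_mono (integrable_of_abs_le hmc.measurable hmb) (hmom n).1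
        fun x => min_le_left _ _).trans (hmom n).2
    refine (hasFiniteIntegral_iff_ofReal (ae_of_all _ hV0)).2 (lt_of_le_of_lt ?_
      (ENNReal.ofReal_lt_top (r := C)))
    have hpt : ∀ x, ENNReal.ofReal (V x) =
        liminf (fun N : ℕ => ENNReal.ofReal (min (V x) N)) atTop := fun x => by
      refine (Tendsto.liminf_eq (tendsto_const_nhds.congr' ?_)).symm
      filter_upwards [eventually_ge_atTop ⌈V x⌉₊] with N hN
      rw [min_eq_left ((Nat.le_ceil _).trans (by exact_mod_cast hN))]
    simp_rw [hpt]
    refine (lintegral_liminf_le fun N =>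
      (hV.measurable.min measurable_const).ennreal_ofReal).trans ?_
    exact liminf_le_of_le (by isBoundedDefault) fun b hb => by
      obtain ⟨N, hN'⟩ := hb.exists
      exact hN'.trans (hN N)
  -- The limit is invariant.
  have hinv : κ.Invariant (μ : Measure E) := by
    have hp : IsProbabilityMeasure ((μ : Measure E).bind κ) :=
      inferInstanceAs (IsProbabilityMeasure (κ ∘ₘ (μ : Measure E)))
    suffices h : (⟨(μ : Measure E).bind κ, hp⟩ : ProbabilityMeasure E) = μ from
      congrArg ProbabilityMeasure.toMeasure h
    refine ProbabilityMeasure.ext_of_forall_lipschitz fun f hfb hfL => ?_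
    obtain ⟨b, hb⟩ := exists_abs_le_of_dist_le hfb
    obtain ⟨L, hL0, hL⟩ := hV.exists_abs_sub_le_weightedDist hd hβ hfb hfL
    have hfc : Continuous f := hfL.choose_spec.continuous
    -- The contraction itself provides the Feller property on bounded Lipschitz functions, as the
    -- weighted distance to `x` vanishes continuously at `x`.
    have hTc : Continuous (transOp κ f) := by
      refine continuous_iff_continuousAt.2 fun x => ?_
      rw [ContinuousAt, tendsto_iff_dist_tendsto_zero]
      have hD : Tendsto (fun y => α * L * weightedDist d V β y x) (𝓝 x) (𝓝 0) := by
        have hc : Continuous fun y => α * L * weightedDist d V β y x := by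
          have := hd.continuous_dist.comp (Continuous.prodMk_left x)
          unfold weightedDist
          exact continuous_const.mul ((this.mul (by fun_prop)).sqrt)
        have h := hc.tendsto x
        simpa [weightedDist, hd.dist_self] using h
      refine squeeze_zero (fun _ => dist_nonneg) (fun y => ?_) hD
      rw [Real.dist_eq]
      exact hcontr f b L hfc.measurable hb hL0 hL y x
    have e : ∫ x, f x ∂((μ : Measure E).bind κ) = ∫ x, transOp κ f x ∂(μ : Measure E) :=
      integral_bind_eq_integral_transOp hfc.measurable hb
    refine e.trans ?_
    -- The difference is `κ^(n+1) f x₀ - κ^n f x₀`, of order `α ^ n`; no Cesàro averaging of the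
    -- laws is required.
    have hdiff : Tendsto (fun n => ∫ x, transOp κ f x ∂(ρ n : Measure E) -
        ∫ x, f x ∂(ρ n : Measure E)) U (𝓝 0) := by
      have hW : Integrable (fun y => 1 + β * (V y + V x₀)) (κ x₀) :=
        (integrable_const _).add (((hV.integrable x₀).add (integrable_const _)).const_mul β)
      have h0 : Tendsto (fun n : ℕ => α ^ n * L * ∫ y, (1 + β * (V y + V x₀)) ∂κ x₀) atTop
          (𝓝 (0 * L * ∫ y, (1 + β * (V y + V x₀)) ∂κ x₀)) :=
        ((tendsto_pow_atTop_nhds_zero_of_lt_one hα0 hα1).mul_const L).mul_const _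
      rw [zero_mul, zero_mul] at h0
      refine squeeze_zero_norm (fun n => ?_) (h0.mono_left hU)
      rw [hρiter n _ b (measurable_transOp hfc.measurable) (abs_transOp_le hb),
        hρiter n _ b hfc.measurable hb, ← Function.iterate_succ_apply,
        Function.iterate_succ_apply']
      have hci : Integrable ((transOp κ)^[n] f) (κ x₀) :=
        integrable_of_abs_le (measurable_iterate_transOp hfc.measurable n)
          (abs_iterate_transOp_le hb n)
      have : transOp κ ((transOp κ)^[n] f) x₀ - (transOp κ)^[n] f x₀ =
          ∫ y, ((transOp κ)^[n] f y - (transOp κ)^[n] f x₀) ∂κ x₀ := by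
        rw [integral_sub hci (integrable_const _)]; simp [transOp]
      rw [this, ← integral_const_mul]
      refine norm_integral_le_of_norm_le (hW.const_mul _) (ae_of_all _ fun y => ?_)
      refine (hiter f b L hfc.measurable hb hL0 hL n y x₀).trans ?_
      gcongr
      exact hV.weightedDist_le hd hβ y x₀
    have := tendsto_nhds_unique hdiff ((hlim hTc (abs_transOp_le hb)).sub (hlim hfc hb))
    linarith
  -- Geometric convergence to the limit.
  have hconv : ∀ f : E → ℝ, (∃ C : ℝ, ∀ x y, dist (f x) (f y) ≤ C) → (∃ L, LipschitzWith L f) →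
      ∃ A : ℝ, 0 ≤ A ∧ ∀ j x,
        |(transOp κ)^[j] f x - ∫ y, f y ∂(μ : Measure E)| ≤ α ^ j * A * V x := by
    intro f hfb hfL
    obtain ⟨b, hb⟩ := exists_abs_le_of_dist_le hfb
    obtain ⟨L, hL0, hL⟩ := hV.exists_abs_sub_le_weightedDist hd hβ hfb hfL
    have hfm : Measurable f := hfL.choose_spec.continuous.measurable
    have hm0 : 0 ≤ ∫ y, V y ∂(μ : Measure E) := integral_nonneg hV0
    refine ⟨L * (1 + β + β * ∫ y, V y ∂(μ : Measure E)), by positivity, fun j x => ?_⟩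
    have hVi : Integrable (fun y => V x + V y) (μ : Measure E) := (integrable_const _).add hμV
    have hW : Integrable (fun y => 1 + β * (V x + V y)) (μ : Measure E) :=
      (integrable_const _).add (hVi.const_mul β)
    have hji : Integrable ((transOp κ)^[j] f) (μ : Measure E) :=
      integrable_of_abs_le (measurable_iterate_transOp hfm j) (abs_iterate_transOp_le hb j)
    have e : (transOp κ)^[j] f x - ∫ y, f y ∂(μ : Measure E) =
        ∫ y, ((transOp κ)^[j] f x - (transOp κ)^[j] f y) ∂(μ : Measure E) := by
      rw [integral_sub (integrable_const _) hji, hinv.integral_iterate_transOp hfm hb j]; simp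
    rw [e]
    calc |∫ y, ((transOp κ)^[j] f x - (transOp κ)^[j] f y) ∂(μ : Measure E)|
        ≤ ∫ y, α ^ j * L * (1 + β * (V x + V y)) ∂(μ : Measure E) := by
          refine norm_integral_le_of_norm_le
            (f := fun y => (transOp κ)^[j] f x - (transOp κ)^[j] f y) (hW.const_mul _)
            (ae_of_all _ fun y => ?_)
          refine (hiter f b L hfm hb hL0 hL j x y).trans ?_
          gcongr
          exact hV.weightedDist_le hd hβ x y
      _ = α ^ j * L * (1 + β * (V x + ∫ y, V y ∂(μ : Measure E))) := by
          rw [integral_const_mul, integral_add (integrable_const _) (hVi.const_mul β),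
            integral_const_mul, integral_add (integrable_const _) hμV]
          simp
      _ ≤ α ^ j * L * ((1 + β + β * ∫ y, V y ∂(μ : Measure E)) * V x) := by
          gcongr
          have := hV.one_le x
          nlinarith [mul_nonneg (mul_nonneg hβ.le hm0) (sub_nonneg.2 this)]
      _ = _ := by ring
  refine ⟨μ, hinv, hμV, fun μ' hinv' => ?_, fun f hfb hfL ε hε => ?_⟩
  · refine ProbabilityMeasure.ext_of_forall_lipschitz fun f hfb hfL => ?_
    obtain ⟨b, hb⟩ := exists_abs_le_of_dist_le hfb
    obtain ⟨A, hA0, hA⟩ := hconv f hfb hfL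
    have hfm : Measurable f := hfL.choose_spec.continuous.measurable
    have h1 : Tendsto (fun j => ∫ x, (transOp κ)^[j] f x ∂(μ' : Measure E)) atTop
        (𝓝 (∫ _, (∫ y, f y ∂(μ : Measure E)) ∂(μ' : Measure E))) := by
      refine tendsto_integral_of_dominated_convergence (fun _ => b)
        (fun j => (measurable_iterate_transOp hfm j).aestronglyMeasurable) (integrable_const _)
        (fun j => ae_of_all _ (abs_iterate_transOp_le hb j)) (ae_of_all _ fun x => ?_)
      rw [tendsto_iff_dist_tendsto_zero]
      have h0 := ((tendsto_pow_atTop_nhds_zero_of_lt_one hα0 hα1).mul_const A).mul_const (V x)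
      rw [zero_mul, zero_mul] at h0
      exact squeeze_zero (fun _ => dist_nonneg) (fun j => by rw [Real.dist_eq]; exact hA j x) h0
    simp only [hinv'.integral_iterate_transOp hfm hb] at h1
    simpa using tendsto_nhds_unique tendsto_const_nhds h1
  · obtain ⟨A, hA0, hA⟩ := hconv f hfb hfL
    have h0 := (tendsto_pow_atTop_nhds_zero_of_lt_one hα0 hα1).mul_const A
    rw [zero_mul] at h0
    obtain ⟨j, hj⟩ := (h0.eventually (ge_mem_nhds hε)).exists
    exact ⟨j, fun x => (hA j x).trans (mul_le_mul_of_nonneg_right hj (hV0 x))⟩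

end InvariantMeasure

/-! ### From bounded Lipschitz observables to weak convergence and unbounded observables. -/

section Empirical

theorem integral_empiricalDistribution {E : Type*} [MeasurableSpace E] [MeasurableSingletonClass E]
    (x : ℕ → E) (n : ℕ) (f : E → ℝ) :
    ∫ y, f y ∂(empiricalDistribution x n : Measure E) =
      (∑ t ∈ Finset.range (n + 1), f (x t)) / ((n + 1 : ℕ) : ℝ) := by
  change ∫ y, f y ∂(((n : ℝ≥0∞) + 1)⁻¹ • ∑ t ∈ Finset.range (n + 1), Measure.dirac (x t)) = _
  rw [integral_smul_measure, integral_finsetSum_measure fun t _ => integrable_dirac (by simp)]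
  simp only [integral_dirac, smul_eq_mul]
  rw [div_eq_inv_mul, ENNReal.toReal_inv]
  congr 2
  rw [ENNReal.toReal_add (by simp) (by simp)]
  simp

/-- Averages over `x 1, …, x n` and averages over `x 0, …, x (n - 1)` have the same limit. -/
theorem tendsto_average_Icc {a : ℕ → ℝ} {m : ℝ}
    (h : Tendsto (fun n : ℕ => (∑ t ∈ Finset.range n, a t) / n) atTop (𝓝 m)) :
    Tendsto (fun n : ℕ => 1 / (n : ℝ) * ∑ t ∈ Finset.Icc 1 n, a t) atTop (𝓝 m) := by
  have h1 := h.comp (tendsto_add_atTop_nat 1)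
  have h2 : Tendsto (fun n : ℕ => ((n : ℝ) + 1) / n) atTop (𝓝 1) := by
    have := (tendsto_const_nhds (x := (1 : ℝ))).add (tendsto_one_div_atTop_nhds_zero_nat (𝕜 := ℝ))
    rw [add_zero] at this
    refine this.congr' ?_
    filter_upwards [eventually_ge_atTop 1] with n hn
    have : (n : ℝ) ≠ 0 := by positivity
    field_simp
  have h3 := (h1.mul h2).sub (tendsto_const_div_atTop_nhds_zero_nat (a 0))
  rw [mul_one, sub_zero] at h3
  refine h3.congr' ?_
  filter_upwards [eventually_ge_atTop 1] with n hn
  have h4 : ∑ t ∈ Finset.range (n + 1), a t = a 0 + ∑ t ∈ Finset.Icc 1 n, a t := by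
    rw [Finset.range_eq_Ico, Finset.sum_eq_sum_Ico_succ_bot (by omega)]
    congr 1
  have : (n : ℝ) ≠ 0 := by positivity
  have : (n : ℝ) + 1 ≠ 0 := by positivity
  simp only [Function.comp_apply, h4]
  push_cast
  field_simp
  ring

section InfConvolution

variable {E : Type*} [PseudoMetricSpace E] {f : E → ℝ} {b : ℝ}

/-- The largest `k`-Lipschitz minorant of `f`. -/
noncomputable def lipschitzMinorant (f : E → ℝ) (k : ℕ) (x : E) : ℝ := ⨅ y, (f y + k * dist x y)

theorem bddBelow_lipschitzMinorant (hb : ∀ x, |f x| ≤ b) (k : ℕ) (x : E) :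
    BddBelow (Set.range fun y => f y + k * dist x y) := by
  refine ⟨-b, ?_⟩
  rintro _ ⟨y, rfl⟩
  have h1 := (abs_le.1 (hb y)).1
  have h2 := mul_nonneg (Nat.cast_nonneg (α := ℝ) k) (dist_nonneg (x := x) (y := y))
  dsimp only
  linarith

theorem lipschitzMinorant_le (hb : ∀ x, |f x| ≤ b) (k : ℕ) (x : E) :
    lipschitzMinorant f k x ≤ f x := by
  simpa [lipschitzMinorant] using ciInf_le (bddBelow_lipschitzMinorant hb k x) x

theorem abs_lipschitzMinorant_le (hb : ∀ x, |f x| ≤ b) (k : ℕ) (x : E) :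
    |lipschitzMinorant f k x| ≤ b := by
  have : Nonempty E := ⟨x⟩
  refine abs_le.2 ⟨le_ciInf fun y => ?_, (lipschitzMinorant_le hb k x).trans (abs_le.1 (hb x)).2⟩
  have := (abs_le.1 (hb y)).1
  have := mul_nonneg (Nat.cast_nonneg (α := ℝ) k) (dist_nonneg (x := x) (y := y))
  linarith

theorem lipschitzWith_lipschitzMinorant (hb : ∀ x, |f x| ≤ b) (k : ℕ) :
    LipschitzWith k (lipschitzMinorant f k) := by
  refine LipschitzWith.of_le_add_mul _ fun x y => ?_
  have : Nonempty E := ⟨x⟩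
  rw [← sub_le_iff_le_add]
  refine le_ciInf fun z => ?_
  rw [sub_le_iff_le_add]
  refine (ciInf_le (bddBelow_lipschitzMinorant hb k x) z).trans ?_
  have := mul_le_mul_of_nonneg_left (dist_triangle x y z) (Nat.cast_nonneg (α := ℝ) k)
  simp only [NNReal.coe_natCast]
  linarith

/-- Once `k δ ≥ 2 b`, points farther than `δ` from `x` are too costly to bring the infimum below `f
x`, and at nearer points `f` is close to `f x`. -/
theorem tendsto_lipschitzMinorant (hb : ∀ x, |f x| ≤ b) {x : E} (hx : ContinuousAt f x) :
    Tendsto (fun k => lipschitzMinorant f k x) atTop (𝓝 (f x)) := by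
  have : Nonempty E := ⟨x⟩
  rw [Metric.tendsto_atTop]
  intro ε hε
  obtain ⟨δ, hδ, h⟩ := Metric.continuousAt_iff.1 hx (ε / 2) (by positivity)
  obtain ⟨N, hN⟩ := exists_nat_ge (2 * b / δ)
  refine ⟨N, fun k hk => ?_⟩
  have hlow : f x - ε / 2 ≤ lipschitzMinorant f k x := by
    refine le_ciInf fun y => ?_
    have h0 := mul_nonneg (Nat.cast_nonneg (α := ℝ) k) (dist_nonneg (x := x) (y := y))
    rcases lt_or_ge (dist y x) δ with hy | hy
    · have := h hy
      rw [Real.dist_eq] at this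
      linarith [(abs_lt.1 this).1]
    · have h1 : 2 * b ≤ k * dist x y := by
        rw [dist_comm x y]
        calc 2 * b ≤ N * δ := (div_le_iff₀ hδ).1 hN
          _ ≤ k * dist y x := by gcongr
      linarith [(abs_le.1 (hb y)).1, (abs_le.1 (hb x)).2]
  rw [Real.dist_eq, abs_lt]
  constructor <;> linarith [lipschitzMinorant_le hb k x]

end InfConvolution

section Determining

variable {E : Type*} [PseudoMetricSpace E] [MeasurableSpace E] [BorelSpace E]
  [SecondCountableTopology E]

open TopologicalSpace in
/-- On a separable metric space, weak convergence of probability measures is determined by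
countably many bounded Lipschitz functions. -/
theorem exists_countable_convergence_determining :
    ∃ S : Set (E → ℝ), S.Countable ∧
      (∀ f ∈ S, (∃ C : ℝ, ∀ x y, dist (f x) (f y) ≤ C) ∧ ∃ L, LipschitzWith L f) ∧
      ∀ (μs : ℕ → ProbabilityMeasure E) (μ : ProbabilityMeasure E),
        (∀ f ∈ S, Tendsto (fun n => ∫ x, f x ∂(μs n : Measure E)) atTop
          (𝓝 (∫ x, f x ∂(μ : Measure E)))) → Tendsto μs atTop (𝓝 μ) := by
  classical
  have hc : Countable (countableBasis E) := (countable_countableBasis E).to_subtype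
  let C : Finset (countableBasis E) → Set E := fun i => (⋃ b ∈ i, (b : Set E))ᶜ
  have hC : ∀ i, IsClosed (C i) := fun i =>
    (isOpen_biUnion fun b _ => isOpen_of_mem_countableBasis b.2).isClosed_compl
  have hδ : ∀ n : ℕ, 0 < (1 : ℝ) / (n + 1) := fun n => by positivity
  let g : Finset (countableBasis E) × ℕ → E → ℝ := fun p x =>
    (thickenedIndicator (hδ p.2) (C p.1) x : ℝ)
  have hg1 : ∀ p x, g p x ≤ 1 := fun p x =>
    NNReal.coe_le_one.2 (thickenedIndicator_le_one (hδ p.2) (C p.1) x)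
  have hg0 : ∀ p x, 0 ≤ g p x := fun p x => NNReal.coe_nonneg _
  have hgL : ∀ p, ∃ L, LipschitzWith L (g p) := fun p =>
    ⟨_, lipschitzWith_thickenedIndicator (hδ p.2) (C p.1)⟩
  refine ⟨Set.range g, Set.countable_range g, ?_, fun μs μ h => ?_⟩
  · rintro _ ⟨p, rfl⟩
    refine ⟨⟨1, fun x y => ?_⟩, hgL p⟩
    rw [Real.dist_eq, abs_le]
    constructor <;> linarith [hg0 p x, hg1 p x, hg0 p y, hg1 p y]
  refine tendsto_of_forall_isClosed_limsup_real_le' fun F hF => ?_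
  refine le_of_forall_pos_le_add fun ε hε => ?_
  -- The open set `Fᶜ` is a directed union of finite unions of basic sets, so its measure is
  -- approximated by one of them. Countably many closed sets `C i` thus approximate every closed `F`
  -- from outside, as the portmanteau criterion requires.
  obtain ⟨i, hFi, hi⟩ : ∃ i, F ⊆ C i ∧
      (μ : Measure E).real (C i) < (μ : Measure E).real F + ε / 2 := by
    let ι := {i : Finset (countableBasis E) // ∀ b ∈ i, (b : Set E) ⊆ Fᶜ}
    have hdir : Directed (· ⊆ ·) fun i : ι => ⋃ b ∈ i.1, (b : Set E) := fun i j =>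
      ⟨⟨i.1 ∪ j.1, fun b hb => (Finset.mem_union.1 hb).elim (i.2 b) (j.2 b)⟩,
        Set.biUnion_subset_biUnion_left fun b hb => Finset.mem_union_left _ hb,
        Set.biUnion_subset_biUnion_left fun b hb => Finset.mem_union_right _ hb⟩
    have hU : ⋃ i : ι, ⋃ b ∈ i.1, (b : Set E) = Fᶜ := by
      refine Set.Subset.antisymm (Set.iUnion_subset fun i => Set.iUnion₂_subset i.2) fun x hx => ?_
      obtain ⟨b, hb, hxb, hbF⟩ := (isBasis_countableBasis E).exists_subset_of_mem_open hx
        hF.isOpen_compl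
      refine Set.mem_iUnion.2 ⟨⟨{⟨b, hb⟩}, by simpa using hbF⟩, ?_⟩
      simpa using hxb
    have hm := hdir.measure_iUnion (μ := (μ : Measure E))
    rw [hU] at hm
    by_contra! hcon
    have hle : (μ : Measure E) Fᶜ ≤ ENNReal.ofReal ((μ : Measure E).real Fᶜ - ε / 2) := by
      rw [hm]
      refine iSup_le fun i => ?_
      rw [← ofReal_measureReal (measure_ne_top _ _)]
      refine ENNReal.ofReal_le_ofReal ?_
      have h1 := hcon i.1 (Set.subset_compl_comm.1 (Set.iUnion₂_subset i.2))
      have h2 := probReal_compl_eq_one_sub (μ := (μ : Measure E)) (hC i.1).measurableSet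
      have h3 := probReal_compl_eq_one_sub (μ := (μ : Measure E)) hF.measurableSet
      simp only [C, compl_compl] at h1 h2
      linarith
    rw [← ofReal_measureReal] at hle
    rcases le_or_gt ((μ : Measure E).real Fᶜ - ε / 2) 0 with h0 | h0
    · have h1 := hcon ∅ (by simp [C])
      have h3 := probReal_compl_eq_one_sub (μ := (μ : Measure E)) hF.measurableSet
      have h4 : (μ : Measure E).real (C ∅) = 1 := by simp [C]
      have h5 := (ENNReal.ofReal_eq_zero.2 h0) ▸ hle
      have h6 := ENNReal.ofReal_eq_zero.1 (le_antisymm h5 zero_le)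
      linarith
    · have := (ENNReal.ofReal_le_ofReal_iff h0.le).1 hle
      linarith
  have key : Tendsto (fun n => ∫ x, g (i, n) x ∂(μ : Measure E)) atTop
      (𝓝 ((μ : Measure E).real (C i))) :=
    tendsto_integral_thickenedIndicator_of_isClosed (μ : Measure E) (hC i)
      (δs := fun n => (1 : ℝ) / (n + 1)) hδ tendsto_one_div_add_atTop_nhds_zero_nat
  obtain ⟨n, hn⟩ := (key.eventually_lt_const
    (show _ < (μ : Measure E).real (C i) + ε / 2 by linarith)).exists
  have hev := (h _ ⟨(i, n), rfl⟩).eventually_lt_const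
    (show _ < (μ : Measure E).real F + ε by linarith)
  refine limsup_le_of_le (isCoboundedUnder_le_of_le atTop (x := 0) fun _ => measureReal_nonneg) ?_
  filter_upwards [hev] with m hm
  refine le_trans ?_ hm.le
  rw [← integral_indicator_one hF.measurableSet]
  have hgi : Integrable (g (i, n)) (μs m : Measure E) :=
    Integrable.of_bound (hgL (i, n)).choose_spec.continuous.measurable.aestronglyMeasurable 1
      (ae_of_all _ fun x => by rw [Real.norm_eq_abs, abs_of_nonneg (hg0 _ x)]; exact hg1 _ x)
  refine integral_mono ((integrable_const (1 : ℝ)).indicator hF.measurableSet) hgi fun x => ?_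
  by_cases hx : x ∈ F
  · simp only [Set.indicator_of_mem hx, Pi.one_apply, g]
    rw [thickenedIndicator_one (hδ n) (C i) (hFi hx)]; simp
  · simp only [Set.indicator_of_notMem hx]
    exact hg0 _ x

end Determining

section Averages

variable {E : Type*} [PseudoMetricSpace E] [MeasurableSpace E] [BorelSpace E]
  {μ : Measure E} [IsProbabilityMeasure μ] {x : ℕ → E}

omit [IsProbabilityMeasure μ] in
-- Observables are not assumed measurable; almost everywhere continuity makes them almost everywhere
-- limits of their Lipschitz minorants.
theorem aestronglyMeasurable_of_ae_continuousAt {f : E → ℝ} {b : ℝ} (hb : ∀ y, |f y| ≤ b)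
    (hf : ∀ᵐ y ∂μ, ContinuousAt f y) : AEStronglyMeasurable f μ :=
  aestronglyMeasurable_of_tendsto_ae atTop
    (fun k => (lipschitzWith_lipschitzMinorant hb k).continuous.measurable.aestronglyMeasurable)
    (hf.mono fun _ hy => tendsto_lipschitzMinorant hb hy)

variable (hx : ∀ f : E → ℝ, (∃ C : ℝ, ∀ y z, dist (f y) (f z) ≤ C) → (∃ L, LipschitzWith L f) →
  Tendsto (fun n : ℕ => (∑ t ∈ Finset.range n, f (x t)) / n) atTop (𝓝 (∫ y, f y ∂μ)))
include hx

/-- By dominated convergence some Lipschitz minorant still has integral above `a`, and its averages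
bound those of `f` from below. Applied to `-f`, this gives the upper bound as well. -/
theorem eventually_lt_average {f : E → ℝ} {b : ℝ} (hb : ∀ y, |f y| ≤ b)
    (hf : ∀ᵐ y ∂μ, ContinuousAt f y) {a : ℝ} (ha : a < ∫ y, f y ∂μ) :
    ∀ᶠ n : ℕ in atTop, a < (∑ t ∈ Finset.range n, f (x t)) / n := by
  have h1 : Tendsto (fun k => ∫ y, lipschitzMinorant f k y ∂μ) atTop (𝓝 (∫ y, f y ∂μ)) :=
    tendsto_integral_of_dominated_convergence (fun _ => b)
      (fun k => (lipschitzWith_lipschitzMinorant hb k).continuous.measurable.aestronglyMeasurable)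
      (integrable_const _) (fun k => ae_of_all _ (abs_lipschitzMinorant_le hb k))
      (hf.mono fun _ hy => tendsto_lipschitzMinorant hb hy)
  obtain ⟨k, hk⟩ := (h1.eventually_const_lt ha).exists
  have h2 := hx (lipschitzMinorant f k) ⟨b + b, fun y z => by
    rw [Real.dist_eq]
    exact (abs_sub _ _).trans (add_le_add (abs_lipschitzMinorant_le hb k y)
      (abs_lipschitzMinorant_le hb k z))⟩ ⟨_, lipschitzWith_lipschitzMinorant hb k⟩
  filter_upwards [h2.eventually_const_lt hk] with n hn
  refine hn.trans_le ?_
  gcongr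
  exact lipschitzMinorant_le hb k _

/-- If averages of bounded Lipschitz functions converge to their integrals, then so do averages of
bounded almost everywhere continuous functions. -/
theorem tendsto_average_of_ae_continuousAt {f : E → ℝ} {b : ℝ} (hb : ∀ y, |f y| ≤ b)
    (hf : ∀ᵐ y ∂μ, ContinuousAt f y) :
    Tendsto (fun n : ℕ => (∑ t ∈ Finset.range n, f (x t)) / n) atTop (𝓝 (∫ y, f y ∂μ)) := by
  refine tendsto_order.2 ⟨fun a ha => eventually_lt_average hx hb hf ha, fun a ha => ?_⟩
  have h := eventually_lt_average hx (f := fun y => -f y) (b := b) (a := -a)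
    (fun y => by rw [abs_neg]; exact hb y) (hf.mono fun _ hy => hy.neg)
    (by rw [integral_neg]; linarith)
  filter_upwards [h] with n hn
  rw [Finset.sum_neg_distrib, neg_div] at hn
  linarith

end Averages

section Unbounded

variable {E : Type*} [PseudoMetricSpace E] [MeasurableSpace E] [BorelSpace E]
  {μ : Measure E} [IsProbabilityMeasure μ] {V φ : E → ℝ} {A : ℝ}

/-- The truncation of `φ` to the interval `[-R, R]`. -/
noncomputable def truncate (R : ℝ) (φ : E → ℝ) (y : E) : ℝ := max (-R) (min (φ y) R)

omit [PseudoMetricSpace E] [MeasurableSpace E] [BorelSpace E] in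
theorem abs_truncate_le {R : ℝ} (hR : 0 ≤ R) (y : E) : |truncate R φ y| ≤ R :=
  abs_le.2 ⟨le_max_left _ _, max_le (by linarith) (min_le_right _ _)⟩

omit [PseudoMetricSpace E] [MeasurableSpace E] [BorelSpace E] in
-- Truncation acts only where `|φ| ≥ R`, and there `|φ| ≤ φ² / R`.
theorem abs_sub_truncate_le {R : ℝ} (hR : 0 < R) (hφ : ∀ y, φ y ^ 2 ≤ A * V y) (y : E) :
    |φ y - truncate R φ y| ≤ A / R * V y := by
  have h0 : 0 ≤ A / R * V y := by
    rw [div_mul_eq_mul_div]; exact div_nonneg ((sq_nonneg _).trans (hφ y)) hR.le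
  have hsq : ∀ z : ℝ, R ≤ z → z ^ 2 ≤ A * V y → z ≤ A / R * V y := fun z hz h => by
    rw [div_mul_eq_mul_div, le_div_iff₀ hR]
    nlinarith
  unfold truncate
  rcases le_total (φ y) R with h1 | h1
  · rw [min_eq_left h1]
    rcases le_total (-R) (φ y) with h2 | h2
    · rw [max_eq_right h2, sub_self, abs_zero]; exact h0
    · rw [max_eq_left h2, abs_of_nonpos (by linarith)]
      have := hsq (-φ y) (by linarith) (by rw [neg_sq]; exact hφ y)
      linarith
  · rw [min_eq_right h1, max_eq_right (by linarith), abs_of_nonneg (by linarith)]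
    have := hsq (φ y) h1 (hφ y)
    linarith

omit [MeasurableSpace E] [BorelSpace E] in
theorem ContinuousAt.truncate {R : ℝ} {y : E} (h : ContinuousAt φ y) :
    ContinuousAt (truncate R φ) y :=
  continuousAt_const.max (h.min continuousAt_const)

theorem integrable_of_ae_continuousAt (hVi : Integrable V μ) (hφ : ∀ y, φ y ^ 2 ≤ A * V y)
    (hc : ∀ᵐ y ∂μ, ContinuousAt φ y) : Integrable φ μ := by
  have hm : AEStronglyMeasurable φ μ := by
    refine aestronglyMeasurable_of_tendsto_ae (u := atTop) (f := fun k : ℕ => truncate (k : ℝ) φ)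
      (fun k => aestronglyMeasurable_of_ae_continuousAt (abs_truncate_le (Nat.cast_nonneg k))
        (hc.mono fun _ hy => hy.truncate)) (ae_of_all _ fun y => ?_)
    refine tendsto_const_nhds.congr' ?_
    filter_upwards [eventually_ge_atTop ⌈|φ y|⌉₊] with k hk
    have h : |φ y| ≤ k := (Nat.le_ceil _).trans (by exact_mod_cast hk)
    rw [abs_le] at h
    rw [truncate, min_eq_left h.2, max_eq_right h.1]
  refine ((integrable_const (1 : ℝ)).add (hVi.const_mul A)).mono' hm (ae_of_all _ fun y => ?_)
  simp only [Real.norm_eq_abs, Pi.add_apply]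
  nlinarith [hφ y, sq_abs (φ y), sq_nonneg (|φ y| - 1)]

/-- If averages of bounded Lipschitz functions converge to their integrals, and averages of `V` are
bounded, then averages of almost everywhere continuous functions `φ = O(√V)` converge to their
integrals. -/
theorem tendsto_average_of_sq_le {x : ℕ → E}
    (hx : ∀ f : E → ℝ, (∃ C : ℝ, ∀ y z, dist (f y) (f z) ≤ C) → (∃ L, LipschitzWith L f) →
      Tendsto (fun n : ℕ => (∑ t ∈ Finset.range n, f (x t)) / n) atTop (𝓝 (∫ y, f y ∂μ)))
    {B : ℝ} (hB0 : 0 ≤ B) (hB : ∀ n : ℕ, ∑ t ∈ Finset.range n, V (x t) ≤ B * n)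
    (hVi : Integrable V μ) (hV0 : ∀ y, 0 ≤ V y) (hA : 0 ≤ A) (hφ : ∀ y, φ y ^ 2 ≤ A * V y)
    (hc : ∀ᵐ y ∂μ, ContinuousAt φ y) :
    Tendsto (fun n : ℕ => (∑ t ∈ Finset.range n, φ (x t)) / n) atTop (𝓝 (∫ y, φ y ∂μ)) := by
  have hφi := integrable_of_ae_continuousAt hVi hφ hc
  have hI : 0 ≤ ∫ y, V y ∂μ := integral_nonneg hV0
  rw [Metric.tendsto_atTop]
  intro ε hε
  set M := B + ∫ y, V y ∂μ + 1 with hM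
  have hM0 : 0 < M := by positivity
  -- With this level the two truncation errors, in the time average and in the integral, total at
  -- most `ε / 3`.
  set R := 3 * (A + 1) * M / ε with hR
  have hR0 : 0 < R := by positivity
  have hsmall : A / R * M ≤ ε / 3 := by
    rw [hR, div_div_eq_mul_div, div_mul_eq_mul_div, div_le_div_iff₀ (by positivity) (by norm_num)]
    nlinarith [mul_pos hε hM0]
  have hAR : 0 ≤ A / R := by positivity
  have hTb := abs_truncate_le (φ := φ) hR0.le
  have hTc : ∀ᵐ y ∂μ, ContinuousAt (truncate R φ) y := hc.mono fun _ hy => hy.truncate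
  have hTi : Integrable (truncate R φ) μ :=
    Integrable.of_bound (aestronglyMeasurable_of_ae_continuousAt hTb hTc) R (ae_of_all _ hTb)
  obtain ⟨N, hN⟩ := Metric.tendsto_atTop.1 (tendsto_average_of_ae_continuousAt hx hTb hTc)
    (ε / 3) (by positivity)
  refine ⟨max N 1, fun n hn => ?_⟩
  have hn0 : (0 : ℝ) < n := by exact_mod_cast (le_max_right N 1).trans hn
  have h1 := hN n ((le_max_left N 1).trans hn)
  have h2 : |(∑ t ∈ Finset.range n, φ (x t)) / n - (∑ t ∈ Finset.range n, truncate R φ (x t)) / n|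
      ≤ A / R * B := by
    rw [← sub_div, ← Finset.sum_sub_distrib, abs_div, abs_of_pos hn0, div_le_iff₀ hn0]
    calc |∑ t ∈ Finset.range n, (φ (x t) - truncate R φ (x t))|
        ≤ ∑ t ∈ Finset.range n, |φ (x t) - truncate R φ (x t)| := Finset.abs_sum_le_sum_abs _ _
      _ ≤ ∑ t ∈ Finset.range n, A / R * V (x t) :=
          Finset.sum_le_sum fun t _ => abs_sub_truncate_le hR0 hφ _
      _ = A / R * ∑ t ∈ Finset.range n, V (x t) := by rw [Finset.mul_sum]
      _ ≤ A / R * (B * n) := by gcongr; exact hB n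
      _ = _ := by ring
  have h3 : |∫ y, φ y ∂μ - ∫ y, truncate R φ y ∂μ| ≤ A / R * ∫ y, V y ∂μ := by
    rw [← integral_sub hφi hTi, ← integral_const_mul]
    exact norm_integral_le_of_norm_le (f := fun y => φ y - truncate R φ y) (hVi.const_mul _)
      (ae_of_all _ fun y => abs_sub_truncate_le hR0 hφ y)
  have h4 : A / R * B + A / R * ∫ y, V y ∂μ ≤ A / R * M := by rw [hM]; nlinarith
  rw [Real.dist_eq] at h1 ⊢
  rw [abs_lt] at h1 ⊢
  rw [abs_le] at h2 h3
  constructor <;> linarith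

end Unbounded

end Empirical

/-! ### Stability of the chain. -/

section StableChain

variable {E : Type*} [MetricSpace E] [MeasurableSpace E] [BorelSpace E]
  [SecondCountableTopology E] {κ : Kernel E E} [IsMarkovKernel κ] {V : E → ℝ} {γ K γ₂ K₂ : ℝ}

theorem IsLyapunov.isStableChain [Nonempty E] (hV : IsLyapunov κ V γ K)
    (hV2 : IsLyapunov κ (fun x => V x ^ 2) γ₂ K₂) {μ : ProbabilityMeasure E}
    (hμ : ∀ f : E → ℝ, (∃ C : ℝ, ∀ x y, dist (f x) (f y) ≤ C) → (∃ L, LipschitzWith L f) →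
      ∀ ε > 0, ∃ j : ℕ, ∀ x, |(transOp κ)^[j] f x - ∫ y, f y ∂(μ : Measure E)| ≤ ε * V x) :
    IsStableChain κ μ := by
  intro ν _
  -- The exceptional null set of the strong law depends on the observable; a countable determining
  -- class leaves a single null set.
  obtain ⟨S, hS, hSL, hdet⟩ := exists_countable_convergence_determining (E := E)
  have hae : ∀ᵐ x ∂markovChainLaw κ ν, ∀ f ∈ S,
      Tendsto (fun n : ℕ => (∑ t ∈ Finset.range n, f (x t)) / n) atTop
        (𝓝 (∫ y, f y ∂(μ : Measure E))) := by
    refine (ae_ball_iff hS).2 fun f hf => ?_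
    obtain ⟨b, hb⟩ := exists_abs_le_of_dist_le (hSL f hf).1
    exact ae_tendsto_average hV hV2 ν (hSL f hf).2.choose_spec.continuous.measurable hb
      (hμ f (hSL f hf).1 (hSL f hf).2)
  filter_upwards [hae] with x hx
  refine hdet _ μ fun f hf => ?_
  simp only [integral_empiricalDistribution]
  exact (hx f hf).comp (tendsto_add_atTop_nat 1)

omit [SecondCountableTopology E] in
theorem tendsto_average_of_tendsto_empiricalDistribution {x : ℕ → E} {μ : ProbabilityMeasure E}
    (hx : Tendsto (fun n => empiricalDistribution x n) atTop (𝓝 μ)) {f : E → ℝ}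
    (hb : ∃ C : ℝ, ∀ y z, dist (f y) (f z) ≤ C) (hL : ∃ L, LipschitzWith L f) :
    Tendsto (fun n : ℕ => (∑ t ∈ Finset.range n, f (x t)) / n) atTop
      (𝓝 (∫ y, f y ∂(μ : Measure E))) := by
  have h := tendsto_iff_forall_lipschitz_integral_tendsto.1 hx f hb hL
  simp only [integral_empiricalDistribution] at h
  exact (tendsto_add_atTop_iff_nat (f := fun n : ℕ => (∑ t ∈ Finset.range n, f (x t)) / n) 1).1 h

end StableChain

/-! ### Poisson exponential moments and elementary exponential bounds. -/

section Poisson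

theorem integrable_exp_mul_poissonMeasure (x : ℝ≥0) (u : ℝ) :
    Integrable (fun n : ℕ => Real.exp (u * n)) (poissonMeasure x) := by
  rw [integrable_poissonMeasure_iff]
  refine ((Real.summable_pow_div_factorial (x * Real.exp u)).mul_left
    (Real.exp (-x))).congr fun n => ?_
  rw [Real.norm_eq_abs, Real.abs_exp, mul_pow, ← Real.exp_nat_mul, mul_comm (n : ℝ) u]
  ring

theorem integral_exp_mul_poissonMeasure (x : ℝ≥0) (u : ℝ) :
    ∫ n : ℕ, Real.exp (u * n) ∂poissonMeasure x = Real.exp (x * (Real.exp u - 1)) := by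
  rw [integral_poissonMeasure]
  have h : ∀ n : ℕ, (Real.exp (-x) * (x : ℝ) ^ n / (n.factorial : ℝ)) • Real.exp (u * n) =
      Real.exp (-x) * ((x * Real.exp u) ^ n / (n.factorial : ℝ)) := fun n => by
    rw [smul_eq_mul, mul_pow, ← Real.exp_nat_mul, mul_comm (n : ℝ) u]
    ring
  simp_rw [h]
  rw [tsum_mul_left, (NormedSpace.expSeries_div_hasSum_exp ((x : ℝ) * Real.exp u)).tsum_eq,
    ← Real.exp_eq_exp_ℝ, ← Real.exp_add]
  ring_nf

end Poisson

section ExpBounds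

theorem exists_mul_exp_le {C s a : ℝ} (hC : 0 ≤ C) (hs : 0 < s) (ha1 : a < 1) :
    ∃ K, 0 ≤ K ∧ ∀ x : ℝ, 0 ≤ x → C * Real.exp (s * a * x) ≤ 1 / 2 * Real.exp (s * x) + K := by
  have hsa : 0 < s * (1 - a) := mul_pos hs (by linarith)
  obtain ⟨X, hX⟩ : ∃ X : ℝ, ∀ x, X ≤ x → C * Real.exp (-(s * (1 - a)) * x) ≤ 1 / 2 := by
    have h : Tendsto (fun x : ℝ => C * Real.exp (-(s * (1 - a)) * x)) atTop (𝓝 (C * 0)) := by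
      refine (Real.tendsto_exp_atBot.comp ?_).const_mul C
      exact tendsto_id.const_mul_atTop_of_neg (by linarith)
    rw [mul_zero] at h
    exact eventually_atTop.1 (h.eventually (ge_mem_nhds (by norm_num)))
  refine ⟨C * Real.exp (s * |a| * |X|), by positivity, fun x hx => ?_⟩
  rcases le_total X x with h | h
  · have e : C * Real.exp (s * a * x) =
        C * Real.exp (-(s * (1 - a)) * x) * Real.exp (s * x) := by
      rw [mul_assoc C, ← Real.exp_add]; ring_nf
    rw [e]
    have := mul_le_mul_of_nonneg_right (hX x h) (Real.exp_pos (s * x)).le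
    have : 0 ≤ C * Real.exp (s * |a| * |X|) := by positivity
    linarith
  · have h1 : s * a * x ≤ s * |a| * |X| := by
      have h2 : x ≤ |X| := h.trans (le_abs_self X)
      calc s * a * x ≤ s * |a| * x := by gcongr; exact le_abs_self a
        _ ≤ _ := by gcongr
    have h3 : C * Real.exp (s * a * x) ≤ C * Real.exp (s * |a| * |X|) := by gcongr
    linarith [Real.exp_pos (s * x)]

theorem exists_one_add_rpow_sq_le {s : ℝ} (hs : 0 < s) {k : ℝ} (hk : 0 ≤ k) :
    ∃ A, 0 ≤ A ∧ ∀ x : ℝ, 0 ≤ x → (1 + x ^ k) ^ 2 ≤ A * Real.exp (s * x) := by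
  set m := ⌈k⌉₊
  set N := 2 * m
  refine ⟨4 * ((N.factorial : ℝ) / s ^ N * Real.exp s), by positivity, fun x hx => ?_⟩
  have h1 : x ^ k ≤ (1 + x) ^ m := by
    calc x ^ k ≤ (1 + x) ^ k := Real.rpow_le_rpow hx (by linarith) hk
      _ ≤ (1 + x) ^ (m : ℝ) := Real.rpow_le_rpow_of_exponent_le (by linarith) (Nat.le_ceil k)
      _ = _ := Real.rpow_natCast _ _
  have h2 : (1 : ℝ) ≤ (1 + x) ^ m := one_le_pow₀ (by linarith)
  have h0 : 0 ≤ x ^ k := Real.rpow_nonneg hx k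
  have h3 : (1 + x ^ k) ^ 2 ≤ 4 * (1 + x) ^ N := by
    rw [show (1 + x) ^ N = ((1 + x) ^ m) ^ 2 by rw [← pow_mul, mul_comm]]
    nlinarith
  have h4 := Real.pow_div_factorial_le_exp (s * (1 + x)) (by positivity) N
  rw [mul_pow, div_le_iff₀ (by positivity)] at h4
  have h5 : (1 + x) ^ N ≤ (N.factorial : ℝ) / s ^ N * Real.exp s * Real.exp (s * x) := by
    rw [mul_assoc, ← Real.exp_add, div_mul_eq_mul_div, le_div_iff₀ (by positivity)]
    calc (1 + x) ^ N * s ^ N = s ^ N * (1 + x) ^ N := mul_comm _ _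
      _ ≤ Real.exp (s * (1 + x)) * N.factorial := h4
      _ = _ := by ring_nf
  linarith

end ExpBounds

/-! ### Drift and coupling for the threshold model. -/

namespace SETPARParams

variable (θ : SETPARParams)

theorem transOp_kernel (f : ℝ≥0 → ℝ) (hf : Measurable f) (x : ℝ≥0) :
    transOp θ.kernel f x = ∫ n, f (θ.step x n) ∂poissonMeasure x :=
  integral_map Measurable.of_discrete.aemeasurable hf.aestronglyMeasurable

theorem exp_step_le {s : ℝ} (hs : 0 ≤ s) (x : ℝ≥0) (n : ℕ) :
    Real.exp (s * θ.step x n) ≤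
      Real.exp (s * (θ.d₁ + θ.b₁ * θ.r)) * Real.exp (s * θ.a₁ * x) +
        Real.exp (s * θ.d₂) * Real.exp (s * θ.a₂ * x) * Real.exp (s * θ.b₂ * n) := by
  rw [← Real.exp_add, ← Real.exp_add, ← Real.exp_add]
  unfold step
  split_ifs with h
  · refine (Real.exp_le_exp.2 ?_).trans (le_add_of_nonneg_right (Real.exp_pos _).le)
    have hn : (n : ℝ) ≤ θ.r := by exact_mod_cast h
    push_cast
    have : s * ((θ.b₁ : ℝ) * n) ≤ s * (θ.b₁ * θ.r) := by gcongr
    linarith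
  · refine (Real.exp_le_exp.2 ?_).trans (le_add_of_nonneg_left (Real.exp_pos _).le)
    push_cast
    exact le_of_eq (by ring)

theorem exists_isLyapunov_exp (ha₁ : θ.a₁ < 1) (hab₂ : θ.a₂ + θ.b₂ < 1) :
    ∃ s₀ : ℝ, 0 < s₀ ∧ ∀ s, 0 < s → s ≤ s₀ →
      ∃ γ K, IsLyapunov θ.kernel (fun x => Real.exp (s * x)) γ K := by
  have ha₁' : (θ.a₁ : ℝ) < 1 := by exact_mod_cast ha₁
  have hab₂' : (θ.a₂ : ℝ) + θ.b₂ < 1 := by exact_mod_cast hab₂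
  have hb₂ : (0 : ℝ) < θ.b₂ := by exact_mod_cast θ.b₂_pos
  set a : ℝ := max θ.a₁ ((1 + θ.a₂ + θ.b₂) / 2) with ha
  have ha1 : a < 1 := max_lt ha₁' (by linarith)
  -- The first bound gives `s b₂ ≤ 1`, hence `exp (s b₂) - 1 ≤ s b₂ + (s b₂) ^ 2`; the second lets
  -- the quadratic term use at most half of the gap `1 - a₂ - b₂`.
  refine ⟨min (1 / θ.b₂) ((1 - θ.a₂ - θ.b₂) / (2 * θ.b₂ ^ 2)), by
    refine lt_min (by positivity) (div_pos (by linarith) (by positivity)), fun s hs hs₀ => ?_⟩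
  have hs1 : s * θ.b₂ ≤ 1 := (le_div_iff₀ hb₂).1 (hs₀.trans (min_le_left _ _))
  have hs2 : s * (2 * θ.b₂ ^ 2) ≤ 1 - θ.a₂ - θ.b₂ :=
    (le_div_iff₀ (by positivity)).1 (hs₀.trans (min_le_right _ _))
  have hexp : s * θ.a₂ + (Real.exp (s * θ.b₂) - 1) ≤ s * a := by
    have h := (abs_le.1 (Real.abs_exp_sub_one_sub_id_le (x := s * θ.b₂)
      (by rwa [abs_of_nonneg (by positivity)]))).2
    have h2 : s * ((1 + θ.a₂ + θ.b₂) / 2) ≤ s * a := by gcongr; exact le_max_right _ _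
    nlinarith
  set C₁ := Real.exp (s * (θ.d₁ + θ.b₁ * θ.r))
  set C₂ := Real.exp (s * θ.d₂)
  obtain ⟨K, hK0, hK⟩ := exists_mul_exp_le (C := C₁ + C₂) (by positivity) hs ha1
  have hVm : Measurable fun x : ℝ≥0 => Real.exp (s * x) := by fun_prop
  have hdom : ∀ x : ℝ≥0, Integrable (fun n : ℕ => C₁ * Real.exp (s * θ.a₁ * x) +
      C₂ * Real.exp (s * θ.a₂ * x) * Real.exp (s * θ.b₂ * n)) (poissonMeasure x) := fun x =>
    (integrable_const _).add ((integrable_exp_mul_poissonMeasure x _).const_mul _)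
  have hint : ∀ x : ℝ≥0, Integrable (fun n => Real.exp (s * θ.step x n)) (poissonMeasure x) :=
    fun x => (hdom x).mono' Measurable.of_discrete.aestronglyMeasurable
      (ae_of_all _ fun n => by rw [Real.norm_eq_abs, Real.abs_exp]; exact θ.exp_step_le hs.le x n)
  refine ⟨1 / 2, K, hVm, fun x => Real.one_le_exp (by positivity), by norm_num, by norm_num, hK0,
    fun x => ?_, fun x => ?_⟩
  · exact (integrable_map_measure hVm.aestronglyMeasurable Measurable.of_discrete.aemeasurable).2
      (hint x)
  rw [θ.transOp_kernel _ hVm]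
  refine le_trans ?_ (hK x x.coe_nonneg)
  calc ∫ n, Real.exp (s * θ.step x n) ∂poissonMeasure x
      ≤ ∫ n : ℕ, (C₁ * Real.exp (s * θ.a₁ * x) +
        C₂ * Real.exp (s * θ.a₂ * x) * Real.exp (s * θ.b₂ * n)) ∂poissonMeasure x :=
        integral_mono (hint x) (hdom x) fun n => θ.exp_step_le hs.le x n
    _ = C₁ * Real.exp (s * θ.a₁ * x) +
        C₂ * Real.exp (x * (s * θ.a₂ + (Real.exp (s * θ.b₂) - 1))) := by
        rw [mul_add, mul_comm (x : ℝ) (s * θ.a₂), Real.exp_add,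
          integral_add (integrable_const _)
          ((integrable_exp_mul_poissonMeasure x _).const_mul _),
          integral_const_mul (C₂ * _), integral_exp_mul_poissonMeasure, mul_assoc C₂]
        simp only [integral_const, probReal_univ, smul_eq_mul, one_mul]
    _ ≤ C₁ * Real.exp (s * a * x) + C₂ * Real.exp (s * a * x) := by
        have h1 : s * θ.a₁ * x ≤ s * a * x := by gcongr; exact le_max_left _ _
        have h2 : x * (s * θ.a₂ + (Real.exp (s * θ.b₂) - 1)) ≤ s * a * x := by
          rw [mul_comm (s * a)]; gcongr
        gcongr
    _ = _ := by ring

/-- A bounded distance on the half-line, concave in the usual distance. -/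
noncomputable def expDist (c : ℝ) (x y : ℝ≥0) : ℝ := 1 - Real.exp (-(c * dist x y))

/-- The regime is decided by the count alone, so a common count puts both intensities on the same
affine branch and the jump at the threshold plays no role. -/
theorem dist_step_le {ρ : ℝ} (h₁ : (θ.a₁ : ℝ) ≤ ρ) (h₂ : (θ.a₂ : ℝ) ≤ ρ) (x y : ℝ≥0) (n : ℕ) :
    dist (θ.step x n) (θ.step y n) ≤ ρ * dist x y := by
  rw [NNReal.dist_eq, NNReal.dist_eq]
  unfold step
  split_ifs
  · push_cast
    rw [show (θ.d₁ : ℝ) + θ.a₁ * x + θ.b₁ * n - (θ.d₁ + θ.a₁ * y + θ.b₁ * n) = θ.a₁ * (x - y) by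
      ring, abs_mul, NNReal.abs_eq]
    gcongr
  · push_cast
    rw [show (θ.d₂ : ℝ) + θ.a₂ * x + θ.b₂ * n - (θ.d₂ + θ.a₂ * y + θ.b₂ * n) = θ.a₂ * (x - y) by
      ring, abs_mul, NNReal.abs_eq]
    gcongr

/-- The coupling of two transitions by a common Poisson count and an independent excess. -/
theorem exists_coupling_of_le {c ρ : ℝ} (hc : 0 ≤ c) (h₁ : (θ.a₁ : ℝ) ≤ ρ) (h₂ : (θ.a₂ : ℝ) ≤ ρ)
    {x y : ℝ≥0} (hxy : x ≤ y) :
    ∃ Γ : Measure (ℝ≥0 × ℝ≥0), Γ.map Prod.fst = θ.kernel x ∧ Γ.map Prod.snd = θ.kernel y ∧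
      ∫ p, expDist c p.1 p.2 ∂Γ ≤ 1 - Real.exp (-((1 + c * ρ) * dist x y)) := by
  set ϖ := (poissonMeasure x).prod (poissonMeasure (y - x)) with hϖ
  let F : ℕ × ℕ → ℝ≥0 × ℝ≥0 := fun p => (θ.step x p.1, θ.step y (p.1 + p.2))
  have hF : Measurable F := Measurable.of_discrete
  have hdm : Continuous fun p : ℝ≥0 × ℝ≥0 => expDist c p.1 p.2 := by
    unfold expDist; fun_prop
  refine ⟨ϖ.map F, ?_, ?_, ?_⟩
  · rw [Measure.map_map measurable_fst hF]
    have : Prod.fst ∘ F = θ.step x ∘ Prod.fst := rfl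
    rw [this, ← Measure.map_map Measurable.of_discrete measurable_fst, hϖ, Measure.map_fst_prod,
      measure_univ, one_smul]
    rfl
  · rw [Measure.map_map measurable_snd hF]
    have : Prod.snd ∘ F = θ.step y ∘ fun p : ℕ × ℕ => p.1 + p.2 := rfl
    rw [this, ← Measure.map_map Measurable.of_discrete Measurable.of_discrete]
    have hconv := poissonMeasure_conv_poissonMeasure x (y - x)
    rw [add_tsub_cancel_of_le hxy] at hconv
    exact congrArg (Measure.map (θ.step y)) hconv
  · rw [integral_map hF.aemeasurable hdm.measurable.aestronglyMeasurable]
    have hdist : dist x y = ((y - x : ℝ≥0) : ℝ) := by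
      rw [NNReal.dist_eq, NNReal.coe_sub hxy, abs_sub_comm, abs_of_nonneg]
      exact sub_nonneg.2 (by exact_mod_cast hxy)
    set w : ℝ := Real.exp (-(c * (ρ * dist x y))) with hw
    -- The event of no excess, of probability `exp (-dist x y)`: the counts agree and the next
    -- distance is at most `ρ * dist x y`. Off this event the distance is bounded by 1.
    let Z : Set (ℕ × ℕ) := Set.univ ×ˢ {0}
    have hZ : MeasurableSet Z := MeasurableSet.of_discrete
    have hZm : ϖ.real Z = Real.exp (-dist x y) := by
      rw [measureReal_def, hϖ, Measure.prod_prod, measure_univ, one_mul, ← measureReal_def,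
        poissonMeasure_real_singleton, hdist]
      simp
    have hi : Integrable (fun p => 1 - Z.indicator (fun _ => w) p) ϖ :=
      (integrable_const _).sub ((integrable_const _).indicator hZ)
    have hb : ∀ p, expDist c (F p).1 (F p).2 ≤ 1 - Z.indicator (fun _ => w) p := by
      rintro ⟨n, m⟩
      unfold expDist
      by_cases hm : (n, m) ∈ Z
      · have hm0 : m = 0 := by simpa [Z] using hm
        subst hm0
        rw [Set.indicator_of_mem hm]
        refine sub_le_sub_left (Real.exp_le_exp.2 (neg_le_neg ?_)) 1
        exact mul_le_mul_of_nonneg_left (θ.dist_step_le h₁ h₂ x y n) hc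
      · rw [Set.indicator_of_notMem hm]
        linarith [Real.exp_pos (-(c * dist (F (n, m)).1 (F (n, m)).2))]
    have hd0 : ∀ p, 0 ≤ expDist c (F p).1 (F p).2 := fun p =>
      sub_nonneg.2 (Real.exp_le_one_iff.2 (neg_nonpos.2 (mul_nonneg hc dist_nonneg)))
    calc ∫ p, expDist c (F p).1 (F p).2 ∂ϖ ≤ ∫ p, (1 - Z.indicator (fun _ => w) p) ∂ϖ :=
          integral_mono_of_nonneg (ae_of_all _ hd0) hi (ae_of_all _ hb)
      _ = 1 - Real.exp (-dist x y) * w := by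
          rw [integral_sub (integrable_const _) ((integrable_const _).indicator hZ),
            integral_indicator_const _ hZ, hZm]
          simp
      _ = _ := by rw [hw, ← Real.exp_add]; ring_nf

/-- The left side equals `(1 - exp (-c h)) - exp (-(c - 1) h) (1 - exp (-h))`, and Bernoulli's
inequality gives `1 - exp (-h) ≥ (1 - exp (-c h)) / c`. -/
theorem one_sub_exp_le {c h H : ℝ} (hc : 1 ≤ c) (h0 : 0 ≤ h) (hH : h ≤ H) :
    1 - Real.exp (-((c - 1) * h)) ≤
      (1 - 1 / c * Real.exp (-((c - 1) * H))) * (1 - Real.exp (-(c * h))) := by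
  have hc0 : 0 < c := by linarith
  have hb := one_add_mul_self_le_rpow_one_add (s := Real.exp (-h) - 1) (p := c)
    (by linarith [Real.exp_pos (-h)]) hc
  rw [add_sub_cancel, ← Real.exp_mul, show -h * c = -(c * h) by ring] at hb
  have h1 : 1 / c * (1 - Real.exp (-(c * h))) ≤ 1 - Real.exp (-h) := by
    rw [one_div_mul_eq_div, div_le_iff₀ hc0]; linarith
  have h2 : Real.exp (-((c - 1) * H)) ≤ Real.exp (-((c - 1) * h)) :=
    Real.exp_le_exp.2 (neg_le_neg (mul_le_mul_of_nonneg_left hH (by linarith)))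
  have h3 : Real.exp (-(c * h)) = Real.exp (-((c - 1) * h)) * Real.exp (-h) := by
    rw [← Real.exp_add]; ring_nf
  have h4 : 0 ≤ 1 / c * (1 - Real.exp (-(c * h))) :=
    mul_nonneg (by positivity) (sub_nonneg.2 (Real.exp_le_one_iff.2 (by nlinarith)))
  have h5 := mul_le_mul h2 h1 h4 (Real.exp_pos _).le
  nlinarith

theorem isWeakContraction_expDist (ha₁ : θ.a₁ < 1) (hab₂ : θ.a₂ + θ.b₂ < 1) {s : ℝ} (hs : 0 < s) :
    ∃ c : ℝ, ∃ q : ℝ → ℝ,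
      IsWeakContraction θ.kernel (fun x => Real.exp (s * x)) (expDist c) q := by
  have ha₁' : (θ.a₁ : ℝ) < 1 := by exact_mod_cast ha₁
  have hab₂' : (θ.a₂ : ℝ) + θ.b₂ < 1 := by exact_mod_cast hab₂
  set ρ : ℝ := max θ.a₁ θ.a₂ with hρ
  have hρ1 : ρ < 1 := max_lt ha₁' (by linarith [θ.b₂.coe_nonneg])
  have hρ0 : 0 ≤ ρ := le_max_of_le_left θ.a₁.coe_nonneg
  have h1ρ : 0 < 1 - ρ := by linarith
  -- Chosen so that the coupling exponent `1 + c ρ` equals `c - 1`, strictly below `c`.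
  set c : ℝ := 2 / (1 - ρ) with hc
  have hc1 : 1 ≤ c := by rw [hc, le_div_iff₀ h1ρ]; linarith
  have hc0 : 0 < c := by linarith
  have hcc : 1 + c * ρ = c - 1 := by rw [hc]; field_simp; ring
  have hcoup : ∀ x y : ℝ≥0, ∃ Γ : Measure (ℝ≥0 × ℝ≥0), Γ.map Prod.fst = θ.kernel x ∧
      Γ.map Prod.snd = θ.kernel y ∧
      ∫ p, expDist c p.1 p.2 ∂Γ ≤ 1 - Real.exp (-((c - 1) * dist x y)) := by
    intro x y
    rw [← hcc]
    rcases le_total x y with h | h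
    · exact θ.exists_coupling_of_le hc0.le (le_max_left _ _) (le_max_right _ _) h
    · obtain ⟨Γ, h1, h2, h3⟩ :=
        θ.exists_coupling_of_le hc0.le (le_max_left _ _) (le_max_right _ _) h
      refine ⟨Γ.map Prod.swap, ?_, ?_, ?_⟩
      · rw [Measure.map_map measurable_fst measurable_swap]; exact h2
      · rw [Measure.map_map measurable_snd measurable_swap]; exact h1
      · rw [integral_map measurable_swap.aemeasurable, dist_comm]
        · simpa [expDist, dist_comm] using h3
        · exact Continuous.aestronglyMeasurable (by unfold expDist; fun_prop)
  -- If `V x + V y ≤ R`, then `exp (s x) ≥ 1 + s x` forces `dist x y ≤ R / s`, the range on which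
  -- the rate is needed.
  refine ⟨c, fun R => 1 - 1 / c * Real.exp (-((c - 1) * (R / s))), ?_, ?_, ?_, ?_, ?_, ?_, ?_⟩
  · unfold expDist Function.uncurry; fun_prop
  · exact fun x y => sub_nonneg.2
      (Real.exp_le_one_iff.2 (neg_nonpos.2 (mul_nonneg hc0.le dist_nonneg)))
  · exact fun x y => sub_le_self _ (Real.exp_pos _).le
  · intro x; simp [expDist]
  · refine ⟨(1 + c) / c, fun x y => ?_⟩
    set h := dist x y
    have h0 : 0 ≤ h := dist_nonneg
    have hch : 0 < 1 + c * h := by positivity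
    have he : Real.exp (-(c * h)) ≤ 1 / (1 + c * h) := by
      rw [Real.exp_neg, ← one_div]
      exact one_div_le_one_div_of_le hch (by linarith [Real.add_one_le_exp (c * h)])
    have h1 : min 1 h ≤ (1 + c) / c * (1 - 1 / (1 + c * h)) := by
      rw [show (1 + c) / c * (1 - 1 / (1 + c * h)) = (1 + c) * h / (1 + c * h) by
        field_simp; ring, le_div_iff₀ hch]
      rcases le_total 1 h with h2 | h2
      · rw [min_eq_left h2]; nlinarith
      · rw [min_eq_right h2]; nlinarith [mul_nonneg h0 (mul_nonneg hc0.le (sub_nonneg.2 h2))]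
    refine h1.trans ?_
    unfold expDist
    gcongr
  · intro R
    have : 0 < 1 / c * Real.exp (-((c - 1) * (R / s))) := by positivity
    linarith
  · intro x y
    obtain ⟨Γ, h1, h2, h3⟩ := hcoup x y
    refine ⟨Γ, h1, h2, h3.trans ?_, fun R hR => h3.trans (one_sub_exp_le hc1 dist_nonneg ?_)⟩
    · unfold expDist
      refine sub_le_sub_left (Real.exp_le_exp.2 (neg_le_neg ?_)) 1
      exact mul_le_mul_of_nonneg_right (by linarith) dist_nonneg
    · rw [le_div_iff₀ hs]
      have e1 := Real.add_one_le_exp (s * x)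
      have e2 := Real.add_one_le_exp (s * y)
      have h4 : dist x y ≤ x + y := by
        rw [NNReal.dist_eq, abs_le]
        constructor <;> linarith [x.coe_nonneg, y.coe_nonneg]
      nlinarith

end SETPARParams

/-! ### The main theorem. -/

theorem theorem1 (θ : SETPARParams) (ha₁ : θ.a₁ < 1) (hab₂ : θ.a₂ + θ.b₂ < 1) :
    -- the intensity process of the model is a Markov chain with transition kernel `θ.kernel`
    (∀ (Ω : Type*) (mΩ : MeasurableSpace Ω) (P : Measure Ω) [IsProbabilityMeasure P]
      (𝓕 : Filtration ℕ mΩ) (lam : ℕ → Ω → ℝ≥0) (Y : ℕ → Ω → ℕ), IsSETPAR θ P 𝓕 lam Y →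
        P.map (fun ω t => lam t ω) = markovChainLaw θ.kernel (P.map (lam 0))) ∧
    ∃ μ : ProbabilityMeasure ℝ≥0,
      -- the chain is stable, and `μ` is its unique invariant probability measure
      IsStableChain θ.kernel μ ∧
      Kernel.Invariant θ.kernel (μ : Measure ℝ≥0) ∧
      (∀ μ' : ProbabilityMeasure ℝ≥0, Kernel.Invariant θ.kernel (μ' : Measure ℝ≥0) → μ' = μ) ∧
      -- moments of all orders
      (∀ s : ℝ, 0 ≤ s → Integrable (fun x : ℝ≥0 => (x : ℝ) ^ s) (μ : Measure ℝ≥0)) ∧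
      -- strong law of large numbers, from any initial value (even a random one)
      (∀ φ : ℝ≥0 → ℝ, (∀ᵐ x ∂(μ : Measure ℝ≥0), ContinuousAt φ x) →
        (∃ (c k : ℝ), 0 ≤ k ∧ ∀ x : ℝ≥0, |φ x| ≤ c * (1 + (x : ℝ) ^ k)) →
        Integrable φ (μ : Measure ℝ≥0) ∧
        ∀ (ν : Measure ℝ≥0) [IsProbabilityMeasure ν],
          ∀ᵐ x ∂(markovChainLaw θ.kernel ν),
            Tendsto (fun n : ℕ => (1 / (n : ℝ)) * ∑ t ∈ Finset.Icc 1 n, φ (x t)) atTop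
              (𝓝 (∫ y, φ y ∂(μ : Measure ℝ≥0)))) := by
  refine ⟨fun Ω mΩ P _ 𝓕 lam Y h => h.map_eq_markovChainLaw, ?_⟩
  obtain ⟨s₀, hs₀, hs⟩ := θ.exists_isLyapunov_exp ha₁ hab₂
  have hs2 : 0 < s₀ / 2 := by positivity
  -- Half the admissible exponent is used for `V`, so that `V ^ 2`, with exponent `s₀`, is still a
  -- Lyapunov function, as the martingale estimates demand.
  obtain ⟨γ, K, hV⟩ := hs (s₀ / 2) hs2 (by linarith)
  obtain ⟨γ₂, K₂, hV2⟩ := hs s₀ hs₀ le_rfl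
  have hsq : (fun x : ℝ≥0 => Real.exp (s₀ * x)) =
      fun x : ℝ≥0 => Real.exp (s₀ / 2 * x) ^ 2 := by
    ext x; rw [← Real.exp_nat_mul]; push_cast; ring_nf
  rw [hsq] at hV2
  obtain ⟨c, q, hd⟩ := θ.isWeakContraction_expDist ha₁ hab₂ hs2
  have hcompact : ∀ R, IsCompact {x : ℝ≥0 | Real.exp (s₀ / 2 * x) ≤ R} := fun R => by
    refine (isCompact_Icc (a := (0 : ℝ≥0)) (b := (R / (s₀ / 2)).toNNReal)).of_isClosed_subset
      (isClosed_le (by fun_prop) continuous_const) fun x hx => ⟨zero_le, ?_⟩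
    rw [← NNReal.coe_le_coe]
    refine le_trans ?_ (Real.le_coe_toNNReal _)
    rw [le_div_iff₀ hs2]
    have := Real.add_one_le_exp (s₀ / 2 * x)
    have hx' : Real.exp (s₀ / 2 * x) ≤ R := hx
    linarith
  obtain ⟨μ, hinv, hμV, huniq, hconv⟩ := hV.exists_invariant hd (by fun_prop) hcompact
  have hstable := hV.isStableChain hV2 hconv
  refine ⟨μ, hstable, hinv, huniq, fun t ht => ?_, fun φ hφ hgrowth => ?_⟩
  · obtain ⟨A, hA0, hA⟩ := exists_one_add_rpow_sq_le hs2 ht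
    refine (hμV.const_mul A).mono' ?_ (ae_of_all _ fun x => ?_)
    · exact (measurable_coe_nnreal_real.pow_const t).aestronglyMeasurable
    · have h0 : 0 ≤ (x : ℝ) ^ t := Real.rpow_nonneg x.coe_nonneg t
      rw [Real.norm_eq_abs, abs_of_nonneg h0]
      nlinarith [hA x x.coe_nonneg]
  · obtain ⟨C, k, hk, hC⟩ := hgrowth
    obtain ⟨A, hA0, hA⟩ := exists_one_add_rpow_sq_le hs2 hk
    have hsq : ∀ x, φ x ^ 2 ≤ C ^ 2 * A * Real.exp (s₀ / 2 * x) := fun x => by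
      calc φ x ^ 2 = |φ x| ^ 2 := (sq_abs _).symm
        _ ≤ (C * (1 + (x : ℝ) ^ k)) ^ 2 := pow_le_pow_left₀ (abs_nonneg _) (hC x) 2
        _ = C ^ 2 * (1 + (x : ℝ) ^ k) ^ 2 := mul_pow _ _ _
        _ ≤ C ^ 2 * (A * Real.exp (s₀ / 2 * x)) := by gcongr; exact hA x x.coe_nonneg
        _ = _ := by ring
    refine ⟨integrable_of_ae_continuousAt hμV hsq hφ, fun ν _ => ?_⟩
    filter_upwards [hstable ν, ae_exists_sum_le hV hV2 ν] with x hx hB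
    obtain ⟨B, hB0, hB⟩ := hB
    exact tendsto_average_Icc (tendsto_average_of_sq_le
      (fun f hb hL => tendsto_average_of_tendsto_empiricalDistribution hx hb hL) hB0 hB hμV
      (fun _ => (Real.exp_pos _).le) (by positivity) hsq hφ)
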